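/- For $k\in\mathbb N=\{1,2,\dots\}$ let $Q_k$ be a sesquilinear inner product on $\mathbb C^k$ (linear in the first variable) which is real-valued on $\mathbb R^k\times\mathbb R^k$, and suppose $Q_{k+1}(\mathrm{inc}_k v,\mathrm{inc}_k w)=Q_k(v,w)$ for the inclusion $\mathrm{inc}_k\colon\mathbb C^k\to\mathbb C^{k+1}$, $v\mapsto(v,0)$. For a linear form $L$ on $\mathbb C^k$ let $L^*\in\mathbb C^k$ be the vector with $L=Q_k(\cdot,L^*)$, and put $Q_k^*(L_1,L_2)=Q_k(L_1^*,L_2^*)$. Let $\mathcal L_k$ be an at most countable set of non-zero linear forms on $\mathbb C^k$ with real coefficients such that $L\circ\mathrm{pr}_k\in\mathcal L_{k+1}$ for all $L\in\mathcal L_k$, where $\mathrm{pr}_k\colon\mathbb C^{k+1}\to\mathbb C^k$ is the projection onto the first $k$ components, and write $\mathcal L=\bigcup_k\mathcal L_k$. For a product $P=L_1\cdots L_m$ ($m\ge1$) of elements of $\mathcal L_k$ and $n\in\mathbb N$, let $\mathrm{Mer}_P(B_{1/n})$ be the real Banach space of all $f/P$, where $f$ is a bounded holomorphic function on $B_{1/n}=\{z\in\mathbb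 C^k: Q_k(z,z)^{1/2}<1/n\}$ that is real-valued on $B_{1/n}\cap\mathbb R^k$, with the norm $\|f/P\|=\sup_{B_{1/n}}|f|$. Let $\mathcal M_{\mathcal L}(\mathbb C^k)$ be the locally convex inductive limit of these spaces over all $(n,P)$, a space of meromorphic germs at $0$, and let $\mathcal M_{\mathcal L}(\mathbb C^{\mathbb N})$ be the locally convex inductive limit of the spaces $\mathcal M_{\mathcal L}(\mathbb C^k)$, realized as the space of germs $f_k\circ\pi_k$ with $f_k\in\mathcal M_{\mathcal L}(\mathbb C^k)$ and $\pi_k\colon\mathbb C^{\mathbb N}\to\mathbb C^k$ the projection onto the first $k$ components. For $f\in\mathcal M_{\mathcal L}(\mathbb C^k)$ let $\mathrm{Dep}(f)\subseteq(\mathbb C^k)^*$ be the smallest subspace spanned by linear forms $L_1,\dots,L_n$ such that $f=g\circ(L_1,\dots,L_n)$ for some meromorphic germ $g$ at $0\in\mathbb C^n$. Put $$\perp^{Q_k}_{\mathcal L}=\{(f_1,f_2)\in\mathcal M_{\mathcal L}(\mathbb C^k)^2:\ Q_k^*(\ell_1,\ell_2)=0\text{ for all }\ell_1\in\mathrm{Dep}(f_1),\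 \ell_2\in\mathrm{Dep}(f_2)\}.$$ (a) For every $k$, $\perp^{Q_k}_{\mathcal L}$ is a closed subset of $\mathcal M_{\mathcal L}(\mathbb C^k)\times\mathcal M_{\mathcal L}(\mathbb C^k)$. (b) If moreover $(L\circ\mathrm{pr}_k)^*=\mathrm{inc}_k(L^*)$ for all $k$ and all linear forms $L$ on $\mathbb C^k$, then the union $\bigcup_k\perp^{Q_k}_{\mathcal L}$ (of the images under $f\mapsto f\circ\pi_k$) is a closed subset of $\mathcal M_{\mathcal L}(\mathbb C^{\mathbb N})\times\mathcal M_{\mathcal L}(\mathbb C^{\mathbb N})$. -/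

import Mathlib

open Filter Topology
open scoped BoundedContinuousFunction ComplexConjugate

noncomputable section

namespace MeroGerms

/-- The space `ℂ^k`. -/
abbrev V (k : ℕ) : Type := Fin k → ℂ

/-- The inclusion of `ℝ^k` into `ℂ^k`. -/
def ofRealVec {k : ℕ} (x : Fin k → ℝ) : V k := fun i => (x i : ℂ)

/-! ### Inner products and their duals -/

/-- A sesquilinear inner product on `ℂ^k`, linear in the first variable and conjugate-linear in
the second one, whose restriction to `ℝ^k × ℝ^k` is real-valued. -/
structure RealInner (k : ℕ) where
  form : V k →ₗ[ℂ] V k →ₗ⋆[ℂ] ℂ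
  conj_symm : ∀ z w, conj (form w z) = form z w
  pos : ∀ z, z ≠ 0 → 0 < (form z z).re
  real : ∀ x y : Fin k → ℝ, (form (ofRealVec x) (ofRealVec y)).im = 0

namespace RealInner

variable {k : ℕ} (Q : RealInner k)

/-- The Riesz representation: every linear form on `ℂ^k` is `Q(·, v)` for exactly one `v`. -/
theorem existsUnique_riesz (L : Module.Dual ℂ (V k)) : ∃! v : V k, ∀ z, L z = Q.form z v := by
  let S : V k →ₗ[ℂ] Module.Dual ℂ (V k) :=
    { toFun := fun v =>
        { toFun := fun z => Q.form z (star v)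
          map_add' := fun a b => by simp
          map_smul' := fun c a => by simp }
      map_add' := fun a b => by ext z; simp
      map_smul' := fun c a => by ext z; simp }
  have hS : ∀ v z, S v z = Q.form z (star v) := fun _ _ => rfl
  have hinj : Function.Injective S := by
    refine (injective_iff_map_eq_zero S).2 fun v hv => ?_
    by_contra hne
    have h1 : star v ≠ 0 := by simpa using hne
    have h2 := Q.pos _ h1
    rw [← hS, hv] at h2
    simp at h2
  have hsurj : Function.Surjective S :=
    (LinearMap.injective_iff_surjective_of_finrank_eq_finrank
      (Subspace.dual_finrank_eq (K := ℂ) (V := V k)).symm).1 hinj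
  obtain ⟨v, hv⟩ := hsurj L
  refine ⟨star v, fun z => by rw [← hv, hS], fun w hw => ?_⟩
  have : S (star w) = S v := by
    rw [hv]; ext z; simp [hS, hw]
  rw [← hinj this, star_star]

/-- The vector `L^*` with `L = Q(·, L^*)`. -/
def riesz (L : Module.Dual ℂ (V k)) : V k := (Q.existsUnique_riesz L).choose

theorem riesz_spec (L : Module.Dual ℂ (V k)) (z : V k) : L z = Q.form z (Q.riesz L) :=
  (Q.existsUnique_riesz L).choose_spec.1 z

/-- The dual inner product `Q^*(L₁, L₂) = Q(L₁^*, L₂^*)` on `(ℂ^k)^*`. -/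
def dual (L₁ L₂ : Module.Dual ℂ (V k)) : ℂ := Q.form (Q.riesz L₁) (Q.riesz L₂)

/-- Two linear subspaces of `(ℂ^k)^*` are perpendicular for `Q^*`. -/
def Perp (W W' : Submodule ℂ (Module.Dual ℂ (V k))) : Prop :=
  ∀ w ∈ W, ∀ w' ∈ W', Q.dual w w' = 0

/-- The open ball of radius `r` around `0` for the norm `√Q(z,z)`. -/
def ball (r : ℝ) : Set (V k) := {z | √(Q.form z z).re < r}

end RealInner

/-! ### Germs at the origin -/

/-- The filter at `0` generated by the sets `U \ (H₁ ∪ ⋯ ∪ H_m)` with `U` a neighbourhood of `0` and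
`H₁, …, H_m` finitely many closed linear hyperplanes. A germ along this filter is the germ at `0` of
a function defined off finitely many hyperplanes, so that the (arbitrary) values of a
representative on the polar hyperplanes do not matter. -/
def offHyperplanes (E : Type) [AddCommGroup E] [Module ℂ E] [TopologicalSpace E] : Filter E :=
  𝓝 0 ⊓ ⨅ (L : E →L[ℂ] ℂ) (_ : L ≠ 0), 𝓟 {z | L z ≠ 0}

/-- Germs at `0` of complex functions on `E` defined off finitely many hyperplanes. -/
abbrev GermAt (E : Type) [AddCommGroup E] [Module ℂ E] [TopologicalSpace E] : Type :=
  Germ (offHyperplanes E) ℂ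

theorem tendsto_offHyperplanes {E F : Type} [AddCommGroup E] [Module ℂ E] [TopologicalSpace E]
    [AddCommGroup F] [Module ℂ F] [TopologicalSpace F] (p : E →L[ℂ] F)
    (hp : Function.Surjective p) : Tendsto p (offHyperplanes E) (offHyperplanes F) := by
  refine tendsto_inf.2 ⟨?_, ?_⟩
  · have h : Tendsto p (𝓝 0) (𝓝 0) := by simpa using p.continuous.tendsto 0
    exact h.mono_left inf_le_left
  · refine tendsto_iInf.2 fun L => tendsto_iInf.2 fun hL => tendsto_principal.2 ?_
    have hne : L.comp p ≠ 0 := fun h => hL <| by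
      ext y
      obtain ⟨x, rfl⟩ := hp y
      exact DFunLike.congr_fun h x
    have : offHyperplanes E ≤ 𝓟 {z | L.comp p z ≠ 0} :=
      inf_le_right.trans (iInf₂_le (L.comp p) hne)
    exact this (mem_principal_self _)

/-- Pull-back of germs along a surjective continuous linear map. -/
def pullback {E F : Type} [AddCommGroup E] [Module ℂ E] [TopologicalSpace E]
    [AddCommGroup F] [Module ℂ F] [TopologicalSpace F] (p : E →L[ℂ] F)
    (hp : Function.Surjective p) : GermAt F →ₗ[ℝ] GermAt E where
  toFun f := f.compTendsto p (tendsto_offHyperplanes p hp)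
  map_add' f g := by
    induction f using Germ.inductionOn
    induction g using Germ.inductionOn
    rfl
  map_smul' c f := by
    induction f using Germ.inductionOn
    rfl

/-! ### Locally convex inductive limits

The inductive limit of a system of real topological vector spaces `E i` which is realized by
linear maps `u i` into one fixed vector space `G`: the sum (for a directed system: the union) of the
images, with the finest locally convex vector space topology for which all `u i` are continuous. -/

section LocallyConvexLimit

variable {ι : Type} {E : ι → Type} [∀ i, AddCommGroup (E i)] [∀ i, Module ℝ (E i)]
  {G : Type} [AddCommGroup G] [Module ℝ G]

/-- The underlying vector space of the locally convex inductive limit. -/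
def lcLimit (u : ∀ i, E i →ₗ[ℝ] G) : Submodule ℝ G := ⨆ i, LinearMap.range (u i)

/-- The canonical map of a step into the limit. -/
def lcLimit.incl (u : ∀ i, E i →ₗ[ℝ] G) (i : ι) : E i →ₗ[ℝ] lcLimit u :=
  (u i).codRestrict (lcLimit u) fun x =>
    le_iSup (fun j => LinearMap.range (u j)) i (LinearMap.mem_range_self (u i) x)

/-- The locally convex inductive limit topology. (For topologies in Mathlib, `t ≤ s` means that `t`
is finer than `s`; the infimum of the set below belongs to that set.) -/
abbrev lcLimit.topology [∀ i, TopologicalSpace (E i)] (u : ∀ i, E i →ₗ[ℝ] G) :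
    TopologicalSpace (lcLimit u) :=
  sInf {t : TopologicalSpace (lcLimit u) |
    (∀ i, @Continuous (E i) (lcLimit u) _ t (lcLimit.incl u i)) ∧
    @IsTopologicalAddGroup (lcLimit u) t _ ∧
    @ContinuousSMul ℝ (lcLimit u) _ _ t ∧
    @LocallyConvexSpace ℝ (lcLimit u) _ _ _ _ t}

end LocallyConvexLimit

/-! ### Meromorphic germs with prescribed linear poles -/

/-- A generating set: an at most countable set of non-zero linear forms on `ℂ^k` with real
coefficients. -/
structure IsGeneratingSet {k : ℕ} (𝓛 : Set (Module.Dual ℂ (V k))) : Prop where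
  countable : 𝓛.Countable
  ne_zero : ∀ L ∈ 𝓛, L ≠ 0
  real : ∀ L ∈ 𝓛, ∀ x : Fin k → ℝ, (L (ofRealVec x)).im = 0

/-- The semigroup (without unit) of polynomial functions `L₁ ⋯ L_m`, `m ≥ 1`, generated by `𝓛`. -/
def polarSemigroup {k : ℕ} (𝓛 : Set (Module.Dual ℂ (V k))) : Subsemigroup (V k → ℂ) :=
  Subsemigroup.closure ((fun L : Module.Dual ℂ (V k) => (L : V k → ℂ)) '' 𝓛)

/-- Extension by `0` of a function on a subset of `ℂ^k`. -/
def extZero {k : ℕ} {B : Set (V k)} (f : B → ℂ) : V k → ℂ :=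
  open Classical in fun z => if h : z ∈ B then f ⟨z, h⟩ else 0

theorem extZero_add {k : ℕ} {B : Set (V k)} (f g : B → ℂ) :
    extZero (f + g) = extZero f + extZero g := by
  funext z; by_cases h : z ∈ B <;> simp [extZero, h]

theorem extZero_smul {k : ℕ} {B : Set (V k)} (c : ℝ) (f : B → ℂ) :
    extZero (c • f) = c • extZero f := by
  funext z; by_cases h : z ∈ B <;> simp [extZero, h]

/-- The real Banach space of bounded holomorphic functions on `B` which are real-valued at the real
points of `B`, with the supremum norm. -/
def BHol {k : ℕ} (B : Set (V k)) : Submodule ℝ (B →ᵇ ℂ) where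
  carrier := {f | DifferentiableOn ℂ (extZero f) B ∧
    ∀ x : Fin k → ℝ, ∀ h : ofRealVec x ∈ B, (f ⟨ofRealVec x, h⟩).im = 0}
  add_mem' := fun {f g} hf hg => ⟨by
      rw [BoundedContinuousFunction.coe_add, extZero_add]; exact hf.1.add hg.1,
    fun x h => by simp [hf.2 x h, hg.2 x h]⟩
  zero_mem' := ⟨by
      have : extZero (⇑(0 : B →ᵇ ℂ)) = fun _ => 0 := by funext z; simp [extZero]
      rw [this]; exact differentiableOn_const 0,
    fun x h => by simp⟩
  smul_mem' := fun c f hf => ⟨by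
      rw [BoundedContinuousFunction.coe_smul]
      have : extZero (fun x => c • f x) = c • extZero f := extZero_smul c f
      rw [this]; exact hf.1.const_smul c,
    fun x h => by simp [hf.2 x h]⟩

/-- The map `f ↦ f / P` from the bounded holomorphic functions on `B_{1/(n+1)}` to germs. It is
injective, and its image with the norm transported from `BHol` is the Banach space
`Mer_P(B_{1/(n+1)})`. Here `n` runs through `0, 1, 2, …`. -/
def meroStep {k : ℕ} (Q : RealInner k) (𝓛 : Set (Module.Dual ℂ (V k)))
    (i : ℕ × polarSemigroup 𝓛) :
    BHol (Q.ball (1 / ((i.1 : ℝ) + 1))) →ₗ[ℝ] GermAt (V k) where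
  toFun f := ((fun z => extZero f.1 z / i.2.1 z : V k → ℂ) : GermAt (V k))
  map_add' f g := by
    have h : extZero (⇑(f + g).1) = extZero f.1 + extZero g.1 := extZero_add f.1 g.1
    rw [h, ← Germ.coe_add]
    congr 1
    funext z
    simp [add_div]
  map_smul' c f := by
    have h : extZero (⇑(c • f).1) = c • extZero f.1 := extZero_smul c f.1
    rw [h, RingHom.id_apply, ← Germ.coe_smul]
    congr 1
    funext z
    simp [mul_div_assoc]

/-- The space of meromorphic germs at `0 ∈ ℂ^k` which are real on `ℝ^k` and have linear poles in `𝓛`,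
the inductive limit of the spaces `Mer_P(B_{1/n})`. -/
def Mero {k : ℕ} (Q : RealInner k) (𝓛 : Set (Module.Dual ℂ (V k))) : Submodule ℝ (GermAt (V k)) :=
  lcLimit (meroStep Q 𝓛)

instance {k : ℕ} (Q : RealInner k) (𝓛 : Set (Module.Dual ℂ (V k))) :
    TopologicalSpace (Mero Q 𝓛) :=
  lcLimit.topology (meroStep Q 𝓛)

/-! ### Dependence subspaces and orthogonality -/

/-- The meromorphic germ `f` on `ℂ^k` depends on the subspace `W` of `(ℂ^k)^*`: there are linear forms
`L₁, …, L_n` spanning `W` and a meromorphic germ `g = a / b` at `0 ∈ ℂ^n` (`a`, `b` holomorphic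
germs) such that `f = g ∘ φ`, where `φ = (L₁, …, L_n)`. That `b ∘ φ` does not vanish identically says
that `g ∘ φ` makes sense. -/
def DependsOn {k : ℕ} (f : GermAt (V k)) (W : Submodule ℂ (Module.Dual ℂ (V k))) : Prop :=
  ∃ (n : ℕ) (L : Fin n → Module.Dual ℂ (V k)) (a b : V n → ℂ),
    Submodule.span ℂ (Set.range L) = W ∧ AnalyticAt ℂ a 0 ∧ AnalyticAt ℂ b 0 ∧
    (¬ ∀ᶠ z in 𝓝 (0 : V k), b (fun i => L i z) = 0) ∧
    f * ((fun z => b (fun i => L i z) : V k → ℂ) : GermAt (V k)) =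
      ((fun z => a (fun i => L i z) : V k → ℂ) : GermAt (V k))

/-- The dependence subspace: the smallest subspace of `(ℂ^k)^*` on which `f` depends. -/
def Dep {k : ℕ} (f : GermAt (V k)) : Submodule ℂ (Module.Dual ℂ (V k)) :=
  sInf {W | DependsOn f W}

/-- The relation `{(f₁, f₂) : Dep f₁ ⊥ Dep f₂}` on the space of meromorphic germs. -/
def perpRel {k : ℕ} (Q : RealInner k) (𝓛 : Set (Module.Dual ℂ (V k))) :
    Set (Mero Q 𝓛 × Mero Q 𝓛) :=
  {p | Q.Perp (Dep (p.1 : GermAt (V k))) (Dep (p.2 : GermAt (V k)))}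

/-! ### Infinitely many variables -/

/-- The projection `ℂ^(k+1) → ℂ^k` onto the first `k` components. -/
def pr (k : ℕ) : V (k + 1) →ₗ[ℂ] V k := LinearMap.funLeft ℂ ℂ Fin.castSucc

/-- The inclusion `ℂ^k → ℂ^(k+1)`, `v ↦ (v, 0)`. -/
def inc {k : ℕ} (v : V k) : V (k + 1) := Fin.snoc (α := fun _ => ℂ) v 0

/-- The projection `ℂ^ℕ → ℂ^k` onto the first `k` components. -/
def prN (k : ℕ) : (ℕ → ℂ) →L[ℂ] V k :=
  ContinuousLinearMap.pi fun i : Fin k => ContinuousLinearMap.proj (i : ℕ)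

theorem prN_surjective (k : ℕ) : Function.Surjective (prN k) := fun v =>
  ⟨fun j => if h : j < k then v ⟨j, h⟩ else 0, by ext i; simp [prN]⟩

/-- The map `f ↦ f ∘ π_k` from meromorphic germs on `ℂ^k` to germs on `ℂ^ℕ`. -/
def meroNStep (Q : ∀ k, RealInner k) (𝓛 : ∀ k, Set (Module.Dual ℂ (V k))) (k : ℕ) :
    Mero (Q k) (𝓛 k) →ₗ[ℝ] GermAt (ℕ → ℂ) :=
  (pullback (prN k) (prN_surjective k)).comp (Mero (Q k) (𝓛 k)).subtype

/-- The space of meromorphic germs on `ℂ^ℕ` with linear poles in `⋃ 𝓛 k`, the inductive limit of the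
spaces of meromorphic germs on `ℂ^k`. -/
def MeroN (Q : ∀ k, RealInner k) (𝓛 : ∀ k, Set (Module.Dual ℂ (V k))) :
    Submodule ℝ (GermAt (ℕ → ℂ)) :=
  lcLimit (meroNStep Q 𝓛)

instance (Q : ∀ k, RealInner k) (𝓛 : ∀ k, Set (Module.Dual ℂ (V k))) :
    TopologicalSpace (MeroN Q 𝓛) :=
  lcLimit.topology (meroNStep Q 𝓛)

/-- The canonical map of the meromorphic germs on `ℂ^k` into those on `ℂ^ℕ`. -/
def toMeroN (Q : ∀ k, RealInner k) (𝓛 : ∀ k, Set (Module.Dual ℂ (V k))) (k : ℕ) :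
    Mero (Q k) (𝓛 k) →ₗ[ℝ] MeroN Q 𝓛 :=
  lcLimit.incl (meroNStep Q 𝓛) k

/-- The union over `k` of the orthogonality relations, as a relation on germs on `ℂ^ℕ`. -/
def perpRelN (Q : ∀ k, RealInner k) (𝓛 : ∀ k, Set (Module.Dual ℂ (V k))) :
    Set (MeroN Q 𝓛 × MeroN Q 𝓛) :=
  ⋃ k, Prod.map (toMeroN Q 𝓛 k) (toMeroN Q 𝓛 k) '' perpRel (Q k) (𝓛 k)

end MeroGerms

end

noncomputable section

namespace MeroGerms

/-! ### Osgood's lemma -/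

section Osgood

open Metric MeasureTheory Set

/-! Both spaces are countable inductive limits of Banach spaces in which every step maps compactly
into a later one. Shrinking the ball makes restriction compact (Montel), and multiplying numerator
and denominator by a further polar product brings two fractions over one denominator. In the square
of such a limit a set is closed as soon as its trace on every Banach step is closed
(`isClosed_of_isClosed_steps`): around a point outside the set, one builds an absolutely convex
neighbourhood as an increasing union of compact sets that avoid the closed traces.

It remains to fix a ball and a denominator `P`. The dependence space of `F / P` is the annihilator
of the space of directions `v` along which `F / P` is invariant (`IsFraction.dep_eq`). For subspaces
`K`, `K'` of `ℂ^k`, the annihilators are `Q^*`-perpendicular exactly when every `v` splits as `a +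
b` with `a ∈ K`, `b ∈ K'` and `Q(a, b) = 0` (`RealInner.perp_dualAnnihilator_iff`). This form
survives limits: Pythagoras bounds `a` by `v`, so a subsequence converges, and invariance is a
closed condition on the pair of numerator and direction. The invariance spaces may jump up in the
limit, which only makes the dependence spaces smaller.

For (b), the condition on `L^*` makes `inc` the adjoint of `pr`. Hence `pr` does not increase the
norm, pull-back along `pr` is again a compact step, and orthogonality is preserved and reflected by
it. Together with the injectivity of the maps into the limit, this shows that the trace of the union
on level `k` is the relation of level `k`, so the criterion applies again. -/

theorem torusMap_mem_closedBall {n : ℕ} (c : Fin n → ℂ) {r : ℝ} (hr : 0 ≤ r) (θ : Fin n → ℝ) :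
    torusMap c (fun _ => r) θ ∈ closedBall c r := by
  rw [mem_closedBall, dist_pi_le_iff hr]
  intro i
  simp [torusMap, dist_eq_norm, Complex.norm_exp_ofReal_mul_I, abs_of_nonneg hr]

theorem torusMap_sub_ne_zero {n : ℕ} {c w : Fin n → ℂ} {r : ℝ} (hw : w ∈ ball c r)
    (θ : Fin n → ℝ) (i : Fin n) : torusMap c (fun _ => r) θ i - w i ≠ 0 := by
  have hr : 0 < r := pos_of_mem_ball hw
  intro h
  have h1 : dist (w i) (c i) < r := (dist_le_pi_dist w c i).trans_lt hw
  rw [← sub_eq_zero.1 h] at h1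
  simp [torusMap, dist_eq_norm, Complex.norm_exp_ofReal_mul_I, abs_of_pos hr] at h1

@[fun_prop]
theorem continuous_torusMap {n : ℕ} (c : Fin n → ℂ) (R : Fin n → ℝ) :
    Continuous (torusMap c R) := by
  unfold torusMap; fun_prop

/-- Induction on the dimension: Fubini splits off the first circle, the induction hypothesis
evaluates the inner integral, and the one-variable Cauchy formula the outer one. -/
theorem torusIntegral_cauchy : ∀ (n : ℕ) (c : Fin n → ℂ) (r : ℝ) (f : (Fin n → ℂ) → ℂ),
    ContinuousOn f (closedBall c r) →
    (∀ z ∈ closedBall c r, ∀ i, DifferentiableAt ℂ (fun t => f (Function.update z i t)) (z i)) →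
    ∀ w ∈ ball c r, torusIntegral (fun ζ => (∏ i, (ζ i - w i)⁻¹) * f ζ) c (fun _ => r) =
      (2 * Real.pi * Complex.I) ^ n * f w := by
  intro n
  induction n with
  | zero =>
    intro c r f _ _ w _
    rw [torusIntegral_dim0]
    simp [Subsingleton.elim c w]
  | succ n ih =>
    intro c r f hc hd w hw
    have hr : 0 < r := pos_of_mem_ball hw
    have hmem : ∀ x (y : Fin n → ℂ), x ∈ closedBall (c 0) r → y ∈ closedBall (c ∘ Fin.succ) r →
        (Fin.cons x y : Fin (n + 1) → ℂ) ∈ closedBall c r := by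
      intro x y hx hy
      rw [mem_closedBall, dist_pi_le_iff hr.le] at *
      exact Fin.forall_fin_succ.2 ⟨by simpa using hx, fun i => by simpa using hy i⟩
    have hw0 : w 0 ∈ ball (c 0) r := (dist_le_pi_dist w c 0).trans_lt hw
    have hw' : Fin.tail w ∈ ball (c ∘ Fin.succ) r := by
      rw [mem_ball, dist_pi_lt_iff hr] at *
      exact fun i => hw i.succ
    rw [torusIntegral_succ]
    · have key : ∀ x ∈ sphere (c 0) r,
          torusIntegral (fun y => (∏ i, ((Fin.cons x y : Fin (n + 1) → ℂ) i - w i)⁻¹) *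
            f (Fin.cons x y)) (c ∘ Fin.succ) ((fun _ => r) ∘ Fin.succ) =
          (x - w 0)⁻¹ • ((2 * Real.pi * Complex.I) ^ n * f (Fin.cons x (Fin.tail w))) := by
        intro x hx
        have hx' := sphere_subset_closedBall hx
        have := ih (c ∘ Fin.succ) r (fun y => f (Fin.cons x y))
          (hc.comp (by fun_prop) fun y hy => hmem x y hx' hy)
          (fun z hz i => by
            have := hd _ (hmem x z hx' hz) i.succ
            simpa [Fin.cons_update] using this)
          (Fin.tail w) hw'
        rw [← this, smul_eq_mul, ← torusIntegral_const_mul]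
        congr 1
        funext y
        simp only [Fin.prod_univ_succ, Fin.tail, Fin.cons_zero, Fin.cons_succ]
        ring
      rw [circleIntegral.integral_congr hr.le key]
      have hdiff : DifferentiableOn ℂ (fun x => (2 * Real.pi * Complex.I) ^ n *
          f (Fin.cons x (Fin.tail w))) (closedBall (c 0) r) := by
        intro x hx
        have := hd _ (hmem x _ hx (ball_subset_closedBall hw')) 0
        simp only [Fin.update_cons_zero, Fin.cons_zero] at this
        exact (this.const_mul _).differentiableWithinAt
      rw [hdiff.circleIntegral_sub_inv_smul hw0, smul_eq_mul, Fin.cons_self_tail]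
      ring
    · refine ContinuousOn.integrableOn_compact isCompact_Icc (Continuous.continuousOn ?_)
      refine Continuous.mul (continuous_finsetProd _ fun i _ => Continuous.inv₀ (by fun_prop)
        fun θ => torusMap_sub_ne_zero hw θ i) ?_
      exact hc.comp_continuous (by fun_prop) fun θ => torusMap_mem_closedBall c hr.le θ

/-- Integration against a continuous density over a compact set of angles, as a continuous linear
functional on the bounded continuous functions. -/
def integralFunctional {n : ℕ} (h : (Fin n → ℝ) → ℂ) (hh : Continuous h) (K : Set (Fin n → ℝ))
    (hK : IsCompact K) : ((Fin n → ℝ) →ᵇ ℂ) →L[ℂ] ℂ :=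
  have hint : ∀ g : (Fin n → ℝ) →ᵇ ℂ, IntegrableOn (fun θ => h θ * g θ) K := fun g =>
    (hh.mul g.continuous).continuousOn.integrableOn_compact hK
  LinearMap.mkContinuous
    { toFun := fun g => ∫ θ in K, h θ * g θ
      map_add' := fun g g' => by
        simp only [BoundedContinuousFunction.coe_add, Pi.add_apply, mul_add]
        exact integral_add (hint g) (hint g')
      map_smul' := fun c g => by
        simp only [BoundedContinuousFunction.coe_smul, smul_eq_mul, RingHom.id_apply]
        rw [← integral_const_mul]
        congr 1; funext θ; ring }
    (∫ θ in K, ‖h θ‖) fun g => by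
      simp only [LinearMap.coe_mk, AddHom.coe_mk]
      rw [← integral_mul_const]
      refine norm_integral_le_of_norm_le ?_ (.of_forall fun θ => ?_)
      · exact (hh.norm.mul continuous_const).continuousOn.integrableOn_compact hK
      · rw [norm_mul]
        gcongr
        exact g.norm_coe_le_norm θ

/-- **Osgood's lemma**: a continuous function of several complex variables which is holomorphic in
each variable is analytic. -/
theorem analyticAt_of_separately {n : ℕ} {f : (Fin n → ℂ) → ℂ} {U : Set (Fin n → ℂ)}
    (hU : IsOpen U) (hc : ContinuousOn f U)
    (hd : ∀ z ∈ U, ∀ i, DifferentiableAt ℂ (fun t => f (Function.update z i t)) (z i))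
    {c : Fin n → ℂ} (hcU : c ∈ U) : AnalyticAt ℂ f c := by
  obtain ⟨r, hr, hrU⟩ := nhds_basis_closedBall.mem_iff.1 (hU.mem_nhds hcU)
  -- The Cauchy kernel is treated as an element of the Banach algebra of bounded continuous
  -- functions of the angles: `Y i w` is the function `ζ_i - w_i`, a unit for `w` near `c`.
  -- Inversion is analytic at units, so `f` becomes a continuous functional `Λ` applied to an
  -- analytic function of `w`, and no power series has to be integrated.
  let X : Fin n → ((Fin n → ℝ) →ᵇ ℂ) := fun i =>
    BoundedContinuousFunction.ofNormedAddCommGroup (fun θ => torusMap c (fun _ => r) θ i)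
      (by fun_prop) (‖c‖ + r) fun θ => by
        have h1 := torusMap_mem_closedBall c hr.le θ
        rw [mem_closedBall, dist_eq_norm] at h1
        calc _ ≤ ‖torusMap c (fun _ => r) θ‖ := norm_le_pi_norm _ i
          _ = ‖c + (torusMap c (fun _ => r) θ - c)‖ := by simp
          _ ≤ _ := (norm_add_le _ _).trans (by gcongr)
  let Y : Fin n → (Fin n → ℂ) → ((Fin n → ℝ) →ᵇ ℂ) := fun i w =>
    X i - w i • (1 : (Fin n → ℝ) →ᵇ ℂ)
  have hY : ∀ i w θ, Y i w θ = torusMap c (fun _ => r) θ i - w i := fun i w θ => by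
    simp [Y, X]
  have hYan : ∀ i, AnalyticAt ℂ (Y i) c := fun i =>
    analyticAt_const.sub (AnalyticAt.smul
      (ContinuousLinearMap.analyticAt (ContinuousLinearMap.proj (R := ℂ) (φ := fun _ => ℂ) i) c)
      analyticAt_const)
  have hunit : ∀ i, IsUnit (Y i c) := fun i => by
    let Z : (Fin n → ℝ) →ᵇ ℂ := BoundedContinuousFunction.ofNormedAddCommGroup
      (fun θ => (torusMap c (fun _ => r) θ i - c i)⁻¹)
      (Continuous.inv₀ (by fun_prop) fun θ => torusMap_sub_ne_zero (mem_ball_self hr) θ i) r⁻¹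
      fun θ => by
        simp [torusMap, Complex.norm_exp_ofReal_mul_I, abs_of_pos hr]
    refine IsUnit.of_mul_eq_one Z ?_
    ext θ
    simp only [BoundedContinuousFunction.coe_mul, Pi.mul_apply, hY,
      BoundedContinuousFunction.coe_one, Pi.one_apply]
    exact mul_inv_cancel₀ (torusMap_sub_ne_zero (mem_ball_self hr) θ i)
  have hinv : ∀ a : (Fin n → ℝ) →ᵇ ℂ, IsUnit a → ∀ θ, Ring.inverse a θ = (a θ)⁻¹ := by
    intro a ha θ
    have h1 := congrArg (fun g : (Fin n → ℝ) →ᵇ ℂ => g θ) (Ring.mul_inverse_cancel a ha)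
    simp only [BoundedContinuousFunction.coe_mul, Pi.mul_apply,
      BoundedContinuousFunction.coe_one, Pi.one_apply] at h1
    exact eq_inv_of_mul_eq_one_right h1
  have hev : ∀ᶠ w in 𝓝 c, w ∈ ball c r ∧ ∀ i, IsUnit (Y i w) :=
    Filter.Eventually.and (ball_mem_nhds c hr) <| eventually_all.2 fun i =>
      (hYan i).continuousAt.eventually (Units.isOpen.mem_nhds (hunit i))
  have hct : Continuous fun θ => f (torusMap c (fun _ => r) θ) :=
    hc.comp_continuous (by fun_prop) fun θ => hrU (torusMap_mem_closedBall c hr.le θ)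
  let Λ := integralFunctional (n := n)
    (fun θ => (∏ i : Fin n, (r : ℂ) * Complex.exp (θ i * Complex.I) * Complex.I) *
      f (torusMap c (fun _ => r) θ)) (Continuous.mul (by fun_prop) hct)
    (Icc (0 : Fin n → ℝ) fun _ => 2 * Real.pi) isCompact_Icc
  have hrep : ∀ᶠ w in 𝓝 c, ((2 * Real.pi * Complex.I) ^ n)⁻¹ * Λ (∏ i, Ring.inverse (Y i w)) = f w := by
    filter_upwards [hev] with w hw
    have h2 : (2 * Real.pi * Complex.I : ℂ) ^ n ≠ 0 := by simp
    rw [inv_mul_eq_iff_eq_mul₀ h2, ← torusIntegral_cauchy n c r f (hc.mono hrU)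
      (fun z hz => hd z (hrU hz)) w hw.1, torusIntegral]
    change ∫ θ in _, _ = _
    congr 1
    funext θ
    have : (∏ i, Ring.inverse (Y i w)) θ = ∏ i, (torusMap c (fun _ => r) θ i - w i)⁻¹ := by
      rw [BoundedContinuousFunction.coe_prod, Finset.prod_apply]
      exact Finset.prod_congr rfl fun i _ => by rw [hinv _ (hw.2 i), hY]
    rw [this, smul_eq_mul]
    ring
  refine AnalyticAt.congr (analyticAt_const.mul ((Λ.analyticAt _).comp ?_)) hrep
  refine Finset.analyticAt_fun_prod _ fun i _ => ?_
  obtain ⟨u, hu⟩ := hunit i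
  exact AnalyticAt.fun_comp (by rw [← hu]; exact analyticAt_inverse u) (hYan i)

theorem analyticAt_of_differentiableOn {n : ℕ} {f : (Fin n → ℂ) → ℂ} {U : Set (Fin n → ℂ)}
    (hU : IsOpen U) (hf : DifferentiableOn ℂ f U) {c : Fin n → ℂ} (hc : c ∈ U) :
    AnalyticAt ℂ f c := by
  refine analyticAt_of_separately hU hf.continuousOn (fun z hz i => ?_) hc
  have h1 : DifferentiableAt ℂ f (Function.update z i (z i)) := by
    rw [Function.update_eq_self]; exact hf.differentiableAt (hU.mem_nhds hz)
  exact h1.comp (z i) (hasFDerivAt_update z (z i)).differentiableAt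

/-- **Weierstrass' theorem** in several variables. -/
theorem differentiableOn_of_tendstoUniformlyOn {n : ℕ} {ι : Type*} {l : Filter ι} [l.NeBot]
    {F : ι → (Fin n → ℂ) → ℂ} {f : (Fin n → ℂ) → ℂ} {U : Set (Fin n → ℂ)} (hU : IsOpen U)
    (hF : ∀ j, DifferentiableOn ℂ (F j) U) (h : TendstoUniformlyOn F f l U) :
    DifferentiableOn ℂ f U := by
  have hc : ContinuousOn f U := h.continuousOn (Frequently.of_forall fun j => (hF j).continuousOn)
  intro z hz
  refine (analyticAt_of_separately hU hc (fun z hz i => ?_) hz).differentiableAt.differentiableWithinAt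
  have hcont : Continuous fun t => Function.update z i t := continuous_const.update i continuous_id
  have hV : IsOpen ((fun t => Function.update z i t) ⁻¹' U) := hU.preimage hcont
  have h1 : DifferentiableOn ℂ (fun t => f (Function.update z i t))
      ((fun t => Function.update z i t) ⁻¹' U) := by
    refine TendstoLocallyUniformlyOn.differentiableOn
      (F := fun j t => F j (Function.update z i t)) (φ := l)
      (h.comp _).tendstoLocallyUniformlyOn (.of_forall fun j t ht => ?_) hV
    exact (((hF j).differentiableAt (hU.mem_nhds ht)).comp t
      (hasFDerivAt_update z t).differentiableAt).differentiableWithinAt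
  exact h1.differentiableAt (hV.mem_nhds (by simpa using hz))

end Osgood

/-! ### Countable inductive limits with compact steps -/

section Silva

open Set Metric Pointwise

/-- The image of `C` is compact and misses the closed set `A`, hence has a thickening that misses
`A`. Adding a small multiple of the closed image of the unit ball stays inside it, and this closure
is compact because `T` is a compact operator. -/
theorem exists_compact_enlargement {E F : Type*} [NormedAddCommGroup E] [NormedSpace ℝ E]
    [NormedAddCommGroup F] [NormedSpace ℝ F] (T : E →L[ℝ] F) {K : Set F} (hK : IsCompact K)
    (hTK : ∀ e, ‖e‖ ≤ 1 → T e ∈ K) {A : Set F} (hA : IsClosed A) {C : Set E} (hC : IsCompact C)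
    (hconv : Convex ℝ C) (hbal : Balanced ℝ C) (hdisj : ∀ e ∈ C, T e ∉ A) :
    ∃ C' : Set F, (IsCompact C' ∧ Convex ℝ C' ∧ Balanced ℝ C' ∧ ∀ e ∈ C', e ∉ A) ∧
      (∀ e ∈ C, T e ∈ C') ∧ (C.Nonempty → ∃ ε > 0, ∀ e, ‖e‖ ≤ ε → T e ∈ C') := by
  set D : Set F := closure (T '' closedBall 0 1) with hD
  have hDK : D ⊆ K := closure_minimal (by rintro _ ⟨e, he, rfl⟩; exact hTK e (by simpa using he))
    hK.isClosed
  have hDc : IsCompact D := hK.of_isClosed_subset isClosed_closure hDK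
  have hDconv : Convex ℝ D := ((convex_closedBall (0 : E) 1).linear_image T.toLinearMap).closure
  have hDbal : Balanced ℝ D := by
    refine Balanced.closure ?_
    rintro a ha _ ⟨_, ⟨e, he, rfl⟩, rfl⟩
    exact ⟨a • e, balanced_closedBall_zero (𝕜 := ℝ) a ha ⟨e, he, rfl⟩, by simp⟩
  have hD0 : (0 : F) ∈ D := subset_closure ⟨0, by simp, by simp⟩
  have hTC : IsCompact (T '' C) := hC.image T.continuous
  obtain ⟨δ, hδ, hδA⟩ := hTC.exists_thickening_subset_open hA.isOpen_compl
    (by rintro _ ⟨e, he, rfl⟩; exact hdisj e he)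
  obtain ⟨M, hM⟩ := hDc.isBounded.exists_norm_le
  have hM0 : 0 ≤ M := (norm_nonneg _).trans (hM 0 hD0)
  -- `M` bounds `D`, so `ε • D` stays within distance `δ`; the `+ 1` covers `M = 0`.
  set ε := δ / (2 * (M + 1)) with hε
  have hεpos : 0 < ε := by positivity
  have hεM : ε * M < δ := by
    rw [hε, div_mul_eq_mul_div, div_lt_iff₀ (by positivity)]
    nlinarith
  refine ⟨T '' C + ε • D, ⟨hTC.add (hDc.smul ε), ?_, ?_, ?_⟩, ?_, ?_⟩
  · exact (hconv.linear_image T.toLinearMap).add (hDconv.smul ε)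
  · refine Balanced.add ?_ ?_
    · rintro a ha _ ⟨_, ⟨e, he, rfl⟩, rfl⟩
      exact ⟨a • e, hbal a ha ⟨e, he, rfl⟩, by simp⟩
    · rintro a ha _ ⟨_, ⟨e, he, rfl⟩, rfl⟩
      exact ⟨a • e, hDbal a ha ⟨e, he, rfl⟩, smul_comm ε a e⟩
  · rintro _ ⟨x, hx, _, ⟨d, hd, rfl⟩, rfl⟩
    refine hδA (mem_thickening_iff.2 ⟨x, hx, ?_⟩)
    simp only [dist_eq_norm, add_sub_cancel_left, norm_smul, Real.norm_of_nonneg hεpos.le]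
    exact (mul_le_mul_of_nonneg_left (hM d hd) hεpos.le).trans_lt hεM
  · intro e he
    exact ⟨T e, ⟨e, he, rfl⟩, ε • 0, ⟨0, hD0, rfl⟩, by simp⟩
  · rintro ⟨c, hc⟩
    have hc0 : (0 : E) ∈ C := by simpa using hbal 0 (by simp) ⟨c, hc, rfl⟩
    refine ⟨ε, hεpos, fun e he => ⟨T 0, ⟨0, hc0, rfl⟩, T e, ⟨T (ε⁻¹ • e), subset_closure
      ⟨_, ?_, rfl⟩, ?_⟩, by simp⟩⟩
    · rw [mem_closedBall_zero_iff, norm_smul, norm_inv, Real.norm_of_nonneg hεpos.le]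
      exact inv_mul_le_one_of_le₀ he hεpos.le
    · simp [smul_smul, hεpos.ne']

/-- Starting from `{0}`, the enlargement is iterated along the sequence. The union `U` of the images
is absolutely convex, avoids `A`, and absorbs a ball of every step; its gauge is the required
seminorm. -/
theorem exists_seminorm_of_seq {E : ℕ → Type*} [∀ n, NormedAddCommGroup (E n)]
    [∀ n, NormedSpace ℝ (E n)] {X : Type*} [AddCommGroup X] [Module ℝ X]
    (u : ∀ n, E n →ₗ[ℝ] X) (T : ∀ n, E n →L[ℝ] E (n + 1)) (hu : ∀ n e, u (n + 1) (T n e) = u n e)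
    (K : ∀ n, Set (E (n + 1))) (hK : ∀ n, IsCompact (K n)) (hTK : ∀ n e, ‖e‖ ≤ 1 → T n e ∈ K n)
    (hX : ∀ x, ∃ n e, u n e = x) (A : Set X) (hA : ∀ n, IsClosed {e | u n e ∈ A}) (h0 : 0 ∉ A) :
    ∃ p : Seminorm ℝ X, (∀ n, ∃ C, ∀ e, p (u n e) ≤ C * ‖e‖) ∧ ∀ y, p y < 1 → y ∉ A := by
  let P : ∀ n, Set (E n) → Prop := fun n C =>
    IsCompact C ∧ Convex ℝ C ∧ Balanced ℝ C ∧ ∀ e ∈ C, u n e ∉ A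
  have step : ∀ n (C : {C : Set (E n) // P n C}), ∃ C' : {C : Set (E (n + 1)) // P (n + 1) C},
      (∀ e ∈ C.1, T n e ∈ C'.1) ∧ (C.1.Nonempty → ∃ ε > 0, ∀ e, ‖e‖ ≤ ε → T n e ∈ C'.1) := by
    rintro n ⟨C, h1, h2, h3, h4⟩
    obtain ⟨C', h, h', h''⟩ := exists_compact_enlargement (T n) (hK n) (hTK n) (hA (n + 1)) h1 h2 h3
      (fun e he => by simpa [hu] using h4 e he)
    exact ⟨⟨C', h⟩, h', h''⟩
  choose next hnext hball using step
  let C : ∀ n, {C : Set (E n) // P n C} := fun n =>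
    Nat.rec ⟨{0}, isCompact_singleton, convex_singleton 0, by
      rintro a _ _ ⟨_, rfl, rfl⟩; simp, by rintro _ rfl; simpa using h0⟩ (fun n C => next n C) n
  have hsucc : ∀ n, ∀ e ∈ (C n).1, T n e ∈ (C (n + 1)).1 := fun n => hnext n (C n)
  have hC0 : ∀ n, (0 : E n) ∈ (C n).1 := by
    intro n
    induction n with
    | zero => exact rfl
    | succ n ih => simpa using hsucc n 0 ih
  have habs : ∀ n, ∃ ε > 0, ∀ e, ‖e‖ ≤ ε → T n e ∈ (C (n + 1)).1 := fun n =>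
    hball n (C n) ⟨0, hC0 n⟩
  choose ε hε hεC using habs
  set U : Set X := ⋃ n, u n '' (C n).1 with hU
  have hεU : ∀ n e, ‖e‖ ≤ ε n → u n e ∈ U := fun n e he =>
    mem_iUnion.2 ⟨n + 1, T n e, hεC n e he, hu n e⟩
  have hmono : Monotone fun n => u n '' (C n).1 := by
    refine monotone_nat_of_le_succ fun n => ?_
    rintro _ ⟨e, he, rfl⟩
    exact ⟨T n e, hsucc n e he, hu n e⟩
  have hconv : Convex ℝ U := hmono.directed_le.convex_iUnion fun n =>
    (C n).2.2.1.linear_image (u n)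
  have hbal : Balanced ℝ U := balanced_iUnion fun n => by
    rintro a ha _ ⟨_, ⟨e, he, rfl⟩, rfl⟩
    exact ⟨a • e, (C n).2.2.2.1 a ha ⟨e, he, rfl⟩, by simp⟩
  have habsU : Absorbent ℝ U := by
    rw [absorbent_iff_eventually_nhdsNE_zero]
    intro x
    obtain ⟨n, e, rfl⟩ := hX x
    have h1 : Tendsto (fun c : ℝ => ‖c • e‖) (𝓝 0) (𝓝 0) := by
      have : Continuous fun c : ℝ => ‖c • e‖ := by fun_prop
      simpa using this.tendsto 0
    filter_upwards [nhdsWithin_le_nhds (h1.eventually_le_const (hε n))] with c hc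
    rw [← map_smul]
    exact hεU n _ hc
  refine ⟨gaugeSeminorm hbal hconv habsU, fun n => ⟨(ε n)⁻¹, fun e => ?_⟩, fun y hy => ?_⟩
  · rcases eq_or_ne e 0 with rfl | he
    · simp
    have hne : 0 < ‖e‖ := norm_pos_iff.2 he
    have h1 : gaugeSeminorm hbal hconv habsU (u n ((ε n / ‖e‖) • e)) ≤ 1 := by
      refine gauge_le_one_of_mem (hεU n _ ?_)
      rw [norm_smul, norm_div, norm_norm, Real.norm_of_nonneg (hε n).le, div_mul_cancel₀ _ hne.ne']
    rw [map_smul, map_smul_eq_mul, norm_div, norm_norm, Real.norm_of_nonneg (hε n).le,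
      div_mul_eq_mul_div, div_le_one hne, mul_comm, ← le_div_iff₀ (hε n)] at h1
    rwa [inv_mul_eq_div]
  · have : y ∈ U := setOfPred_gauge_lt_one_subset_self hconv (mem_iUnion.2 ⟨0, 0, hC0 0, map_zero _⟩) habsU hy
    obtain ⟨n, e, he, rfl⟩ := mem_iUnion.1 this
    exact (C n).2.2.2.2 e he

variable {I : Type*} {E : I → Type*} [∀ i, NormedAddCommGroup (E i)] [∀ i, NormedSpace ℝ (E i)]

/-- A compact connecting map between two steps of an inductive limit. -/
def CompactStep {X : Type*} [AddCommGroup X] [Module ℝ X] (u : ∀ i, E i →ₗ[ℝ] X) (i j : I) : Prop :=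
  ∃ T : E i →L[ℝ] E j, (∃ K, IsCompact K ∧ ∀ e, ‖e‖ ≤ 1 → T e ∈ K) ∧ ∀ e, u j (T e) = u i e

theorem CompactStep.trans {X : Type*} [AddCommGroup X] [Module ℝ X] {u : ∀ i, E i →ₗ[ℝ] X}
    {i j k : I} (h : CompactStep u i j) (h' : CompactStep u j k) : CompactStep u i k := by
  obtain ⟨T, ⟨K, hK, hT⟩, hu⟩ := h
  obtain ⟨T', -, hu'⟩ := h'
  exact ⟨T'.comp T, ⟨T' '' K, hK.image T'.continuous, fun e he => ⟨T e, hT e he, rfl⟩⟩,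
    fun e => by simp [hu, hu']⟩

theorem CompactStep.prodMap {X : Type*} [AddCommGroup X] [Module ℝ X] {u : ∀ i, E i →ₗ[ℝ] X}
    {i j : I} (h : CompactStep u i j) :
    CompactStep (E := fun i => E i × E i) (fun i => (u i).prodMap (u i)) i j := by
  obtain ⟨T, ⟨K, hK, hT⟩, hu⟩ := h
  refine ⟨T.prodMap T, ⟨K ×ˢ K, hK.prod hK, fun e he => ⟨hT _ ?_, hT _ ?_⟩⟩, fun e => by simp [hu]⟩
  · exact (norm_fst_le e).trans he
  · exact (norm_snd_le e).trans he

/-- A countable directed index set contains a cofinal sequence of compact steps, which reduces the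
claim to a sequence. -/
theorem exists_seminorm_of_directed [Countable I] {X : Type*} [AddCommGroup X] [Module ℝ X]
    (u : ∀ i, E i →ₗ[ℝ] X) (hdir : Directed (CompactStep u) id) (hX : ∀ x, ∃ i e, u i e = x)
    (A : Set X) (hA : ∀ i, IsClosed {e | u i e ∈ A}) (h0 : 0 ∉ A) :
    ∃ p : Seminorm ℝ X, (∀ i, ∃ C, ∀ e, p (u i e) ≤ C * ‖e‖) ∧ ∀ y, p y < 1 → y ∉ A := by
  obtain ⟨i₀, -⟩ := hX 0
  have : Inhabited I := ⟨i₀⟩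
  have := Encodable.ofCountable I
  let s : ℕ → I := hdir.sequence id
  have h1 : ∀ n, CompactStep u (s n) (s (n + 1)) := hdir.sequence_mono_nat
  have h2 : ∀ i, ∃ n, CompactStep u i (s n) := fun i => ⟨_, hdir.rel_sequence i⟩
  choose T hT hu using h1
  choose K hK hTK using hT
  obtain ⟨p, hp, hpA⟩ := exists_seminorm_of_seq (E := fun n => E (s n)) (fun n => u (s n)) T hu K hK
    hTK (fun x => by
      obtain ⟨i, e, rfl⟩ := hX x
      obtain ⟨n, T, -, h⟩ := h2 i
      exact ⟨n, T e, h e⟩) A (fun n => hA (s n)) h0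
  refine ⟨p, fun i => ?_, hpA⟩
  obtain ⟨n, T, -, h⟩ := h2 i
  obtain ⟨C, hC⟩ := hp n
  refine ⟨max C 0 * ‖T‖, fun e => ?_⟩
  rw [← h e]
  calc _ ≤ C * ‖T e‖ := hC _
    _ ≤ max C 0 * (‖T‖ * ‖e‖) := by gcongr; exacts [le_max_left _ _, T.le_opNorm e]
    _ = _ := by ring

/-- In the square of a countable inductive limit with compact steps, a subset is closed as soon as
its preimages in the steps are closed. -/
theorem isClosed_of_isClosed_steps [Countable I] {X : Type*} [AddCommGroup X] [Module ℝ X]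
    [TopologicalSpace X] [IsTopologicalAddGroup X] (u : ∀ i, E i →ₗ[ℝ] X)
    (hdir : Directed (CompactStep u) id) (hX : ∀ x, ∃ i e, u i e = x)
    (htop : ∀ p : Seminorm ℝ X, (∀ i, ∃ C, ∀ e, p (u i e) ≤ C * ‖e‖) → Continuous p)
    (A : Set (X × X)) (hA : ∀ i, IsClosed {e : E i × E i | (u i e.1, u i e.2) ∈ A}) :
    IsClosed A := by
  rw [← isOpen_compl_iff, isOpen_iff_mem_nhds]
  intro x hx
  have hdir' : Directed (CompactStep (E := fun i => E i × E i) fun i => (u i).prodMap (u i)) id :=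
    fun i j => by
      obtain ⟨k, h, h'⟩ := hdir i j
      exact ⟨k, h.prodMap, h'.prodMap⟩
  have hX' : ∀ x : X × X, ∃ i, ∃ e : E i × E i, (u i).prodMap (u i) e = x := by
    rintro ⟨x, y⟩
    obtain ⟨i, e, rfl⟩ := hX x
    obtain ⟨j, e', rfl⟩ := hX y
    obtain ⟨k, ⟨T, -, h⟩, ⟨T', -, h'⟩⟩ := hdir i j
    exact ⟨k, (T e, T' e'), by simpa using ⟨h e, h' e'⟩⟩
  -- Translation by `x` moves the point to `0`. The trace of the translated set on step `i` is
  -- computed in a common later step `k` which also contains `x`.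
  obtain ⟨p, hp, hpA⟩ := exists_seminorm_of_directed (E := fun i => E i × E i) _ hdir' hX'
    {y | y + x ∈ A} (fun i => by
      obtain ⟨j, e, rfl⟩ := hX' x
      obtain ⟨k, ⟨T, -, h⟩, ⟨T', -, h'⟩⟩ := hdir' i j
      have hc : Continuous fun e' : E i × E i => T e' + T' e := T.continuous.add continuous_const
      convert! (hA k).preimage hc using 1
      ext e'
      have h1 : ((u k).prodMap (u k)) (T e' + T' e) =
          (u i).prodMap (u i) e' + (u j).prodMap (u j) e := by
        rw [map_add]; exact congrArg₂ _ (h e') (h' e)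
      exact iff_of_eq (congrArg (· ∈ A) h1.symm)) (by simpa using hx)
  -- `htop` concerns `X` only, so `p` is controlled through its restrictions to the two factors,
  -- whose sum dominates it.
  have hp1 : Continuous (p.comp (LinearMap.inl ℝ X X)) := htop _ fun i => by
    obtain ⟨C, hC⟩ := hp i
    refine ⟨C, fun e => ?_⟩
    have := hC (e, 0)
    simpa using this
  have hp2 : Continuous (p.comp (LinearMap.inr ℝ X X)) := htop _ fun i => by
    obtain ⟨C, hC⟩ := hp i
    refine ⟨C, fun e => ?_⟩
    have := hC (0, e)
    simpa using this
  have hcont : Continuous fun y : X × X => p.comp (LinearMap.inl ℝ X X) (y.1 - x.1) +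
      p.comp (LinearMap.inr ℝ X X) (y.2 - x.2) :=
    (hp1.comp (continuous_fst.sub continuous_const)).add
      (hp2.comp (continuous_snd.sub continuous_const))
  have hev : ∀ᶠ y in 𝓝 x, p.comp (LinearMap.inl ℝ X X) (y.1 - x.1) +
      p.comp (LinearMap.inr ℝ X X) (y.2 - x.2) < 1 := by
    refine hcont.continuousAt.eventually_lt continuousAt_const ?_
    simp only [sub_self, map_zero]; norm_num
  filter_upwards [hev] with y hy
  have h1 : y - x = LinearMap.inl ℝ X X (y.1 - x.1) + LinearMap.inr ℝ X X (y.2 - x.2) := by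
    ext <;> simp
  have h2 : p (y - x) < 1 := by
    rw [h1]; exact (map_add_le_add p _ _).trans_lt hy
  simpa using hpA _ h2

end Silva

/-! ### The locally convex inductive limit topology -/

section LocallyConvexLimit

variable {ι : Type} {E : ι → Type} [∀ i, AddCommGroup (E i)] [∀ i, Module ℝ (E i)]
  {G : Type} [AddCommGroup G] [Module ℝ G]

theorem lcLimit.isTopologicalAddGroup [∀ i, TopologicalSpace (E i)] (u : ∀ i, E i →ₗ[ℝ] G) :
    @IsTopologicalAddGroup (lcLimit u) (lcLimit.topology u) _ :=
  topologicalAddGroup_sInf fun _ ht => ht.2.1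

/-- A seminorm on the limit which is continuous on the steps is continuous. -/
theorem lcLimit.continuous_seminorm [∀ i, TopologicalSpace (E i)] [∀ i, IsTopologicalAddGroup (E i)]
    (u : ∀ i, E i →ₗ[ℝ] G) (p : Seminorm ℝ (lcLimit u))
    (hp : ∀ i, Continuous fun e => p (lcLimit.incl u i e)) :
    @Continuous _ _ (lcLimit.topology u) _ p := by
  let S := p.toAddGroupSeminorm.toSeminormedAddCommGroup
  let _ : NormedSpace ℝ (lcLimit u) := { norm_smul_le := fun a b => (map_smul_eq_mul p a b).le }
  -- The topology defined by `p` is one of the competitors in the infimum.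
  have hle : lcLimit.topology u ≤ S.toPseudoMetricSpace.toUniformSpace.toTopologicalSpace := by
    refine sInf_le ⟨fun i => ?_, inferInstance, inferInstance, inferInstance⟩
    refine continuous_of_continuousAt_zero (lcLimit.incl u i) ?_
    rw [ContinuousAt, map_zero, tendsto_zero_iff_norm_tendsto_zero]
    have := (hp i).tendsto 0
    rw [map_zero, map_zero] at this
    exact this
  exact continuous_le_dom hle (continuous_norm (E := lcLimit u))

end LocallyConvexLimit

/-! ### Geometry of the inner products -/

/-- Stated for an abstract space because `V k` already carries the supremum norm, which would clash
with the norm of the core. -/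
theorem exists_orthogonal_of_core {E : Type*} [AddCommGroup E] [Module ℂ E] [FiniteDimensional ℂ E]
    (c : InnerProductSpace.Core ℂ E) (K : Submodule ℂ E) (v : E) :
    ∃ a ∈ K, ∀ w ∈ K, c.inner w (v - a) = 0 := by
  let _ : NormedAddCommGroup E := c.toNormedAddCommGroup
  let _ : InnerProductSpace ℂ E := InnerProductSpace.ofCore c.toCore
  obtain ⟨a, ha, b, hb, hab⟩ := K.exists_add_mem_mem_orthogonal v
  refine ⟨a, ha, fun w hw => ?_⟩
  rw [hab, add_sub_cancel_left]
  exact (K.mem_orthogonal b).1 hb w hw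

namespace RealInner

variable {k : ℕ} (Q : RealInner k)

theorem continuous_form : Continuous fun p : V k × V k => Q.form p.1 p.2 := by
  have h : ∀ p : V k × V k, Q.form p.1 p.2 = ∑ i, ∑ j, p.1 i * conj (p.2 j) *
      Q.form (Pi.single i 1) (Pi.single j 1) := by
    rintro ⟨z, w⟩
    have hz : z = ∑ i, z i • Pi.single i (1 : ℂ) := by
      simpa using (pi_eq_sum_univ' z)
    have hw : w = ∑ i, w i • Pi.single i (1 : ℂ) := by
      simpa using (pi_eq_sum_univ' w)
    conv_lhs => rw [hz, hw]
    simp only [map_sum, LinearMap.sum_apply, map_smul, LinearMap.smul_apply, smul_eq_mul,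
      LinearMap.map_smulₛₗ]
    simp only [Finset.mul_sum]
    rw [Finset.sum_comm]
    exact Finset.sum_congr rfl fun i _ => Finset.sum_congr rfl fun j _ => by ring
  simp only [h]
  fun_prop

/-- The squared norm. -/
def sq (z : V k) : ℝ := (Q.form z z).re

theorem continuous_sq : Continuous Q.sq :=
  Complex.continuous_re.comp (Q.continuous_form.comp (continuous_id.prodMk continuous_id))

theorem sq_nonneg (z : V k) : 0 ≤ Q.sq z := by
  rcases eq_or_ne z 0 with rfl | h
  · simp [sq]
  · exact (Q.pos z h).le

theorem eq_zero_of_form_self {z : V k} (h : Q.form z z = 0) : z = 0 := by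
  by_contra hz
  simpa [h] using Q.pos z hz

theorem form_eq_zero_symm {z w : V k} (h : Q.form z w = 0) : Q.form w z = 0 := by
  rw [← Q.conj_symm, h, map_zero]

theorem sq_add_of_form_eq_zero {z w : V k} (h : Q.form z w = 0) :
    Q.sq (z + w) = Q.sq z + Q.sq w := by
  simp [sq, h, Q.form_eq_zero_symm h]

theorem sq_smul (c : ℝ) (z : V k) : Q.sq (c • z) = c ^ 2 * Q.sq z := by
  have : c • z = (c : ℂ) • z := by ext; simp
  simp only [sq, this, map_smul, LinearMap.smul_apply, LinearMap.map_smulₛₗ, Complex.conj_ofReal,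
    smul_eq_mul, ← mul_assoc]
  rw [← Complex.ofReal_mul, Complex.re_ofReal_mul, _root_.sq]

theorem mem_ball {r : ℝ} (hr : 0 < r) {z : V k} : z ∈ Q.ball r ↔ Q.sq z < r ^ 2 :=
  Real.sqrt_lt' hr

theorem isOpen_ball (r : ℝ) : IsOpen (Q.ball r) :=
  isOpen_lt (Real.continuous_sqrt.comp Q.continuous_sq) continuous_const

theorem zero_mem_ball {r : ℝ} (hr : 0 < r) : (0 : V k) ∈ Q.ball r := by
  simpa [ball] using hr

theorem convex_ball {r : ℝ} (hr : 0 < r) : Convex ℝ (Q.ball r) := by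
  intro z hz w hw a b ha hb hab
  rw [Q.mem_ball hr] at *
  have h : Q.sq (a • z + b • w) = a * Q.sq z + b * Q.sq w - a * b * Q.sq (z - w) := by
    have h1 : ∀ (c : ℝ) (z : V k), c • z = (c : ℂ) • z := fun c z => by ext; simp
    have h2 := Q.conj_symm z w
    have h3 : (Q.form w z).re = (Q.form z w).re := by rw [← h2, Complex.conj_re]
    obtain rfl : b = 1 - a := by linarith
    simp only [sq, h1, map_add, map_sub, map_smul, LinearMap.smul_apply, LinearMap.map_smulₛₗ,
      LinearMap.add_apply, LinearMap.sub_apply, Complex.conj_ofReal, smul_eq_mul, Complex.add_re,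
      Complex.sub_re, Complex.re_ofReal_mul, h3]
    ring
  have h4 := mul_nonneg (mul_nonneg ha hb) (Q.sq_nonneg (z - w))
  have h5 : a * Q.sq z + b * Q.sq w < r ^ 2 := by
    rcases ha.eq_or_lt with rfl | ha'
    · obtain rfl : b = 1 := by linarith
      simpa using hw
    · nlinarith
  linarith

theorem isCompact_sq_le (C : ℝ) : IsCompact {z | Q.sq z ≤ C} := by
  refine Metric.isCompact_of_isClosed_isBounded (isClosed_le Q.continuous_sq continuous_const) ?_
  have hc : ∃ c > 0, ∀ z : V k, c * ‖z‖ ^ 2 ≤ Q.sq z := by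
    have key : ∀ c, (∀ z ∈ Metric.sphere (0 : V k) 1, c ≤ Q.sq z) →
        ∀ z : V k, c * ‖z‖ ^ 2 ≤ Q.sq z := by
      intro c hc z
      rcases eq_or_ne z 0 with rfl | hz
      · simp [sq]
      have hz' : ‖z‖ ≠ 0 := norm_ne_zero_iff.2 hz
      have := hc (‖z‖⁻¹ • z) (by simp [norm_smul, hz'])
      rwa [Q.sq_smul, inv_pow, inv_mul_eq_div, le_div_iff₀ (by positivity)] at this
    -- The sphere is empty only for `k = 0`; otherwise `c` is the minimum of `Q.sq` on it.
    rcases (Metric.sphere (0 : V k) 1).eq_empty_or_nonempty with he | hne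
    · exact ⟨1, one_pos, key 1 (by simp [he])⟩
    · obtain ⟨x, hx, hmin⟩ := (isCompact_sphere (0 : V k) 1).exists_isMinOn hne
        Q.continuous_sq.continuousOn
      exact ⟨Q.sq x, Q.pos x (by rintro rfl; simp at hx), key _ hmin⟩
  obtain ⟨c, hc, h⟩ := hc
  refine isBounded_iff_forall_norm_le.2 ⟨√(C / c), fun z hz => Real.le_sqrt_of_sq_le ?_⟩
  rw [le_div_iff₀ hc, mul_comm]
  exact (h z).trans hz

/-- Existence of orthogonal projections. -/
theorem exists_orthogonal (K : Submodule ℂ (V k)) (v : V k) :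
    ∃ a ∈ K, ∀ w ∈ K, Q.form w (v - a) = 0 := by
  let c : InnerProductSpace.Core ℂ (V k) :=
    { inner := fun x y => Q.form y x
      conj_inner_symm := fun x y => Q.conj_symm y x
      re_inner_nonneg := fun x => Q.sq_nonneg x
      add_left := fun x y z => by simp
      smul_left := fun x y r => by simp
      definite := fun x h => Q.eq_zero_of_form_self h }
  obtain ⟨a, ha, h⟩ := exists_orthogonal_of_core c K v
  exact ⟨a, ha, fun w hw => Q.form_eq_zero_symm (h w hw)⟩

theorem riesz_eq {L : Module.Dual ℂ (V k)} {v : V k} (h : ∀ z, L z = Q.form z v) :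
    Q.riesz L = v :=
  (Q.existsUnique_riesz L).unique (Q.riesz_spec L) h

/-- Perpendicularity of annihilators. -/
theorem perp_dualAnnihilator_iff (K K' : Submodule ℂ (V k)) :
    Q.Perp K.dualAnnihilator K'.dualAnnihilator ↔
      ∀ v, ∃ a ∈ K, v - a ∈ K' ∧ Q.form a (v - a) = 0 := by
  constructor
  · intro h v
    obtain ⟨a, ha, hv⟩ := Q.exists_orthogonal K v
    refine ⟨a, ha, ?_, hv a ha⟩
    -- With `a` the orthogonal projection of `v` to `K`, the form represented by `v - a` annihilates
    -- `K`. By assumption it is perpendicular to every form annihilating `K'`, so `v - a` lies in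
    -- `K'`.
    let L : Module.Dual ℂ (V k) := Q.form.flip (v - a)
    have hL : ∀ z, L z = Q.form z (v - a) := fun z => rfl
    rw [← Subspace.dualAnnihilator_dualCoannihilator_eq (W := K'), Submodule.mem_dualCoannihilator]
    intro L' hL'
    rw [Q.riesz_spec L', ← Q.riesz_eq hL]
    exact h L ((Submodule.mem_dualAnnihilator _).2 hv) L' hL'
  · intro h L hL L' hL'
    -- Conversely, split `L^*` itself: its component `a` in `K` is orthogonal both to `L^*` and to
    -- `L^* - a`, hence zero, so `L^*` lies in `K'`.
    obtain ⟨a, ha, hb, hab⟩ := h (Q.riesz L)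
    have h1 : Q.form a (Q.riesz L) = 0 := by
      rw [← Q.riesz_spec]; exact (Submodule.mem_dualAnnihilator _).1 hL a ha
    rw [map_sub, h1, zero_sub, neg_eq_zero] at hab
    rw [Q.eq_zero_of_form_self hab, sub_zero] at hb
    rw [dual, ← Q.riesz_spec]
    exact (Submodule.mem_dualAnnihilator _).1 hL' _ hb

end RealInner

/-! ### Functions defined off hyperplanes -/

theorem offHyperplanes_le_nhds {E : Type} [AddCommGroup E] [Module ℂ E] [TopologicalSpace E] :
    offHyperplanes E ≤ 𝓝 0 := inf_le_left

section Germs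

variable {E : Type} [AddCommGroup E] [Module ℂ E] [TopologicalSpace E] [IsTopologicalAddGroup E]
  [ContinuousSMul ℂ E]

theorem dense_ne_zero {L : E →L[ℂ] ℂ} (hL : L ≠ 0) : Dense {z | L z ≠ 0} := by
  have h : interior ((LinearMap.ker L.toLinearMap : Submodule ℂ E) : Set E) = ∅ := by
    by_contra hne
    have := Submodule.eq_top_of_nonempty_interior' _ (Set.nonempty_iff_ne_empty.2 hne)
    exact hL (ContinuousLinearMap.coe_injective (LinearMap.ker_eq_top.1 this))
  exact interior_eq_empty_iff_dense_compl.1 h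

/-- Dense open sets are stable under finite intersections, so their supersets form a filter; it
contains the complement of every closed hyperplane. -/
theorem exists_dense_of_mem_iInf {s : Set E}
    (hs : s ∈ ⨅ (L : E →L[ℂ] ℂ) (_ : L ≠ 0), 𝓟 {z | L z ≠ 0}) :
    ∃ o ⊆ s, IsOpen o ∧ Dense o := by
  let D : Filter E :=
    { sets := {s | ∃ o ⊆ s, IsOpen o ∧ Dense o}
      univ_sets := ⟨Set.univ, subset_rfl, isOpen_univ, dense_univ⟩
      sets_of_superset := fun ⟨o, h, ho⟩ hst => ⟨o, h.trans hst, ho⟩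
      inter_sets := fun ⟨o, h, ho, hd⟩ ⟨o', h', ho', hd'⟩ =>
        ⟨o ∩ o', Set.inter_subset_inter h h', ho.inter ho', hd.inter_of_isOpen_left hd' ho⟩ }
  have hD : D ≤ ⨅ (L : E →L[ℂ] ℂ) (_ : L ≠ 0), 𝓟 {z | L z ≠ 0} :=
    le_iInf₂ fun L hL => le_principal_iff.2
      ⟨_, subset_rfl, isOpen_ne_fun L.continuous continuous_const, dense_ne_zero hL⟩
  exact hD hs

/-- A continuous function which vanishes near `0` off finitely many hyperplanes vanishes near
`0`. -/
theorem eventually_nhds_of_offHyperplanes {h : E → ℂ} {U : Set E} (hU : IsOpen U)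
    (h0 : (0 : E) ∈ U) (hc : ContinuousOn h U) (hz : ∀ᶠ z in offHyperplanes E, h z = 0) :
    ∀ᶠ z in 𝓝 0, h z = 0 := by
  obtain ⟨t, ht, s, hs, hts⟩ := mem_inf_iff_superset.1 hz
  obtain ⟨o, hos, -, hd⟩ := exists_dense_of_mem_iInf hs
  filter_upwards [interior_mem_nhds.2 ht, hU.mem_nhds h0] with z hz hzU
  have hW : IsOpen (interior t ∩ U) := isOpen_interior.inter hU
  have hcl : z ∈ closure (interior t ∩ U ∩ o) :=
    hd.open_subset_closure_inter hW ⟨hz, hzU⟩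
  have hmaps : Set.MapsTo h (interior t ∩ U ∩ o) {0} := fun w hw =>
    hts ⟨interior_subset hw.1.1, hos hw.2⟩
  have := (hc.mono (Set.inter_subset_right.trans subset_rfl) z ⟨hz, hzU⟩ |>.mono
    Set.inter_subset_left).mem_closure hcl hmaps
  simpa using this

instance : (offHyperplanes E).NeBot := by
  refine ⟨fun h => ?_⟩
  have := eventually_nhds_of_offHyperplanes (E := E) (h := fun _ => 1) isOpen_univ (Set.mem_univ _)
    continuousOn_const (by rw [h]; exact eventually_bot)
  simpa using this.self_of_nhds

end Germs

/-! ### Directions of invariance of a quotient -/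

/-- The quotient `F / P` of a function holomorphic on the convex neighbourhood `B` of `0` by an entire
function which vanishes at most on finitely many hyperplanes near `0`. -/
structure IsFraction {k : ℕ} (B : Set (V k)) (F P : V k → ℂ) : Prop where
  isOpen : IsOpen B
  convex : Convex ℝ B
  zero_mem : 0 ∈ B
  num : DifferentiableOn ℂ F B
  den : Differentiable ℂ P
  ne_zero : ∀ᶠ z in offHyperplanes (V k), P z ≠ 0

/-- `v` is a direction of invariance of `F / P` on `B`. -/
def InvariantDir {k : ℕ} (B : Set (V k)) (F P : V k → ℂ) (v : V k) : Prop :=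
  ∀ z ∈ B, ∀ t : ℂ, z + t • v ∈ B → F (z + t • v) * P z = F z * P (z + t • v)

namespace IsFraction

variable {k : ℕ} {B : Set (V k)} {F P : V k → ℂ}

theorem exists_ne_zero (h : IsFraction B F P) {U : Set (V k)} (hU : U ∈ 𝓝 0) :
    ∃ z ∈ U, P z ≠ 0 :=
  ((h.ne_zero).and (offHyperplanes_le_nhds hU)).exists.imp fun _ hz => ⟨hz.2, hz.1⟩

/-- Invariance propagates from a neighbourhood of a point. -/
theorem invariantDir_of_eventually (h : IsFraction B F P) {v z₀ : V k} (hz₀ : z₀ ∈ B)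
    (hv : ∀ᶠ p : V k × ℂ in 𝓝 (z₀, 0),
      F (p.1 + p.2 • v) * P p.1 = F p.1 * P (p.1 + p.2 • v)) : InvariantDir B F P v := by
  intro z hz t ht
  -- The two points `z` and `z + t • v` are contracted to `z₀` with a complex parameter `s`. The
  -- defect `g` is holomorphic on a convex set of parameters and vanishes near `s = 0`, hence also
  -- at `s = 1`.
  let a : ℂ → V k := fun s => z₀ + s • (z - z₀)
  let b : ℂ → V k := fun s => z₀ + s • (z + t • v - z₀)
  have ha : Differentiable ℂ a := by fun_prop
  have hb : Differentiable ℂ b := by fun_prop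
  have hab : ∀ s, b s = a s + (s * t) • v := fun s => by
    simp only [a, b]; module
  let Ω : Set ℂ := a ⁻¹' B ∩ b ⁻¹' B
  have hΩ : IsOpen Ω := (h.isOpen.preimage ha.continuous).inter (h.isOpen.preimage hb.continuous)
  have hconv : Convex ℝ Ω := by
    have key : ∀ w : V k, Convex ℝ ((fun s : ℂ => z₀ + s • w) ⁻¹' B) := fun w x hx y hy c d hc hd hcd => by
      have := h.convex hx hy hc hd hcd
      have e : z₀ + (c • x + d • y) • w = c • (z₀ + x • w) + d • (z₀ + y • w) := by
        simp only [Complex.real_smul, smul_add, add_smul, mul_smul, Complex.coe_smul]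
        rw [add_add_add_comm, ← add_smul, hcd, one_smul]
      simpa only [Set.mem_preimage, e] using this
    exact (key _).inter (key _)
  let g : ℂ → ℂ := fun s => F (b s) * P (a s) - F (a s) * P (b s)
  have hg : DifferentiableOn ℂ g Ω :=
    ((h.num.comp hb.differentiableOn fun s hs => hs.2).mul (h.den.comp ha).differentiableOn).sub
      ((h.num.comp ha.differentiableOn fun s hs => hs.1).mul (h.den.comp hb).differentiableOn)
  have h0 : (0 : ℂ) ∈ Ω := by simp [Ω, a, b, hz₀]
  have h1 : (1 : ℂ) ∈ Ω := by simp [Ω, a, b, hz, ht]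
  have hev : g =ᶠ[𝓝 0] 0 := by
    have hc : Tendsto (fun s : ℂ => (a s, s * t)) (𝓝 0) (𝓝 (z₀, 0)) := by
      have : Continuous fun s : ℂ => (a s, s * t) := by fun_prop
      simpa [a] using this.tendsto 0
    filter_upwards [hc.eventually hv] with s hs
    simp only [g, hab, Pi.zero_apply]
    exact sub_eq_zero.2 hs
  have := (hg.analyticOnNhd hΩ).eqOn_zero_of_preconnected_of_eventuallyEq_zero
    hconv.isPreconnected h0 hev h1
  simpa [g, a, b, sub_eq_zero] using this

/-- The space of directions of invariance of `F / P`. -/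
def invariants (h : IsFraction B F P) : Submodule ℂ (V k) where
  carrier := {v | InvariantDir B F P v}
  zero_mem' := fun z _ t _ => by simp
  smul_mem' := fun c v hv z hz t ht => by
    rw [smul_smul] at *; exact hv z hz _ ht
  add_mem' := by
    intro v w hv hw
    -- The intermediate point `z + t • v` may leave `B`, and `P` may vanish there. Both are avoided
    -- near a point with `P z₀ ≠ 0`, from which invariance propagates.
    obtain ⟨z₀, hz₀, hP⟩ := h.exists_ne_zero (h.isOpen.mem_nhds h.zero_mem)
    refine h.invariantDir_of_eventually hz₀ ?_
    have h1 : Tendsto (fun p : V k × ℂ => p.1) (𝓝 (z₀, 0)) (𝓝 z₀) := continuous_fst.tendsto _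
    have h2 : Tendsto (fun p : V k × ℂ => p.1 + p.2 • v) (𝓝 (z₀, 0)) (𝓝 z₀) := by
      have : Continuous fun p : V k × ℂ => p.1 + p.2 • v := by fun_prop
      simpa using this.tendsto (z₀, 0)
    have h3 : Tendsto (fun p : V k × ℂ => p.1 + p.2 • (v + w)) (𝓝 (z₀, 0)) (𝓝 z₀) := by
      have : Continuous fun p : V k × ℂ => p.1 + p.2 • (v + w) := by fun_prop
      simpa using this.tendsto (z₀, 0)
    have hB := h.isOpen.mem_nhds hz₀
    filter_upwards [h1.eventually_mem hB, h2.eventually_mem hB, h3.eventually_mem hB,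
      h2.eventually (h.den.continuous.continuousAt.eventually_ne hP)] with p hp1 hp2 hp3 hp4
    have e : p.1 + p.2 • (v + w) = p.1 + p.2 • v + p.2 • w := by module
    rw [e] at hp3 ⊢
    have e1 := hv _ hp1 _ hp2
    have e2 := hw _ hp2 _ hp3
    refine mul_right_cancel₀ hp4 ?_
    linear_combination P p.1 * e2 + P (p.1 + p.2 • v + p.2 • w) * e1

theorem mem_invariants (h : IsFraction B F P) {v : V k} :
    v ∈ h.invariants ↔ InvariantDir B F P v := Iff.rfl

theorem continuous_forms {n : ℕ} (L : Fin n → Module.Dual ℂ (V k)) :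
    Continuous fun z => fun i => L i z :=
  continuous_pi fun i => (L i).continuous_of_finiteDimensional

/-- If `F / P` factors through forms spanning `W`, then a vector killed by `W` does not change these
forms, so it is a direction of invariance. Cancelling `b ∘ φ` is possible near a point where it is
nonzero, which is enough by propagation. -/
theorem dualAnnihilator_le_of_dependsOn (h : IsFraction B F P)
    {W : Submodule ℂ (Module.Dual ℂ (V k))}
    (hW : DependsOn ((fun z => F z / P z : V k → ℂ) : GermAt (V k)) W) :
    h.invariants.dualAnnihilator ≤ W := by
  obtain ⟨n, L, a, b, hspan, ha, hb, hb0, hfg⟩ := hW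
  suffices W.dualCoannihilator ≤ h.invariants by
    have h1 := Submodule.dualAnnihilator_anti this
    rwa [Subspace.dualCoannihilator_dualAnnihilator_eq] at h1
  intro v hv
  have hLv : ∀ i, L i v = 0 := fun i =>
    (Submodule.mem_dualCoannihilator v).1 hv _ (hspan ▸ Submodule.subset_span ⟨i, rfl⟩)
  let φ : V k → V n := fun z i => L i z
  have hφ : Continuous φ := continuous_forms L
  have hφ0 : φ 0 = 0 := by ext; simp [φ]
  have hφt : ∀ z (t : ℂ), φ (z + t • v) = φ z := fun z t => by ext; simp [φ, hLv]
  obtain ⟨A, hA, hA0, hAab⟩ : ∃ A : Set (V n), IsOpen A ∧ 0 ∈ A ∧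
      ∀ y ∈ A, AnalyticAt ℂ a y ∧ AnalyticAt ℂ b y := by
    obtain ⟨A, hA, hA', hA0⟩ := eventually_nhds_iff.1
      (ha.eventually_analyticAt.and hb.eventually_analyticAt)
    exact ⟨A, hA', hA0, hA⟩
  let U := B ∩ φ ⁻¹' A
  have hU : IsOpen U := h.isOpen.inter (hA.preimage hφ)
  have hU0 : (0 : V k) ∈ U := ⟨h.zero_mem, by simpa [hφ0] using hA0⟩
  have hac : ContinuousOn (fun z => a (φ z)) U := fun z hz =>
    ((hAab _ hz.2).1.continuousAt.comp hφ.continuousAt).continuousWithinAt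
  have hbc : ContinuousOn (fun z => b (φ z)) U := fun z hz =>
    ((hAab _ hz.2).2.continuousAt.comp hφ.continuousAt).continuousWithinAt
  have hev : ∀ᶠ z in 𝓝 0, F z * b (φ z) - a (φ z) * P z = 0 := by
    refine eventually_nhds_of_offHyperplanes hU hU0
      (((h.num.continuousOn.mono Set.inter_subset_left).mul hbc).sub
        (hac.mul h.den.continuous.continuousOn)) ?_
    filter_upwards [Germ.coe_eq.1 hfg, h.ne_zero] with z hz hP
    have hz' : F z / P z * b (φ z) = a (φ z) := hz
    rw [← hz']
    field_simp
    ring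
  obtain ⟨U', hU'h, hU', hU'0⟩ := eventually_nhds_iff.1 (hev.and (hU.mem_nhds hU0))
  obtain ⟨z₀, hz₀U, hz₀⟩ : ∃ z₀ ∈ U', b (φ z₀) ≠ 0 := by
    by_contra! hcon
    exact hb0 (mem_of_superset (hU'.mem_nhds hU'0) hcon)
  have hz₀' := (hU'h z₀ hz₀U).2
  refine h.invariantDir_of_eventually hz₀'.1 ?_
  have h1 : Tendsto (fun p : V k × ℂ => p.1) (𝓝 (z₀, 0)) (𝓝 z₀) := continuous_fst.tendsto _
  have h2 : Tendsto (fun p : V k × ℂ => p.1 + p.2 • v) (𝓝 (z₀, 0)) (𝓝 z₀) := by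
    have : Continuous fun p : V k × ℂ => p.1 + p.2 • v := by fun_prop
    simpa using this.tendsto (z₀, 0)
  have h3 : ∀ᶠ z in 𝓝 z₀, b (φ z) ≠ 0 :=
    (hbc.continuousAt (hU.mem_nhds hz₀')).eventually_ne hz₀
  have hN := hU'.mem_nhds hz₀U
  filter_upwards [h1.eventually_mem hN, h2.eventually_mem hN, h1.eventually h3] with p hp1 hp2 hp3
  have e1 := (hU'h _ hp1).1
  have e2 := (hU'h _ hp2).1
  rw [hφt] at e2
  refine mul_right_cancel₀ hp3 ?_
  linear_combination P p.1 * e2 - P (p.1 + p.2 • v) * e1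

theorem exists_section {n : ℕ} (φ : V k →ₗ[ℂ] V n) : ∃ s : V n →ₗ[ℂ] V k, ∀ z, φ (s (φ z)) = φ z := by
  obtain ⟨s, hs⟩ := φ.rangeRestrict.exists_rightInverse_of_surjective (LinearMap.range_rangeRestrict φ)
  obtain ⟨s', hs'⟩ := s.exists_extend
  refine ⟨s', fun z => ?_⟩
  have h1 : s' (φ z) = s (φ.rangeRestrict z) := by rw [← hs']; rfl
  have h2 := congrArg Subtype.val (DFunLike.congr_fun hs (φ.rangeRestrict z))
  rw [h1]
  exact h2

/-- With `φ` given by generators of the annihilator and `s` a generalized inverse of `φ`, the points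
`z` and `s (φ z) + k₀` differ by an element of `ker φ`, hence by a direction of invariance. So `F /
P` is determined by `φ z`. -/
theorem dependsOn_dualAnnihilator (h : IsFraction B F P) :
    DependsOn ((fun z => F z / P z : V k → ℂ) : GermAt (V k)) h.invariants.dualAnnihilator := by
  obtain ⟨n, L, hL⟩ := Submodule.fg_iff_exists_fin_generating_family.1
    (IsNoetherian.noetherian h.invariants.dualAnnihilator)
  let φ : V k →ₗ[ℂ] V n := LinearMap.pi L
  have hφc : Continuous φ := φ.continuous_of_finiteDimensional
  have hker : ∀ v, φ v = 0 → v ∈ h.invariants := by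
    intro v hv
    rw [← Subspace.dualAnnihilator_dualCoannihilator_eq (W := h.invariants), ← hL,
      Submodule.mem_dualCoannihilator]
    intro L' hL'
    induction hL' using Submodule.span_induction with
    | mem x hx => obtain ⟨i, rfl⟩ := hx; exact congrFun hv i
    | zero => rfl
    | add x y _ _ hx hy => simp [hx, hy]
    | smul c x _ hx => simp [hx]
  obtain ⟨s, hs⟩ := exists_section φ
  have hsc : Continuous s := s.continuous_of_finiteDimensional
  have hcont : Continuous fun z => z - s (φ z) := by fun_prop
  obtain ⟨z₀, hz₀, hP⟩ := h.exists_ne_zero (U := (fun z => z - s (φ z)) ⁻¹' B)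
    ((h.isOpen.preimage hcont).mem_nhds (by simpa using h.zero_mem))
  -- The denominator could vanish identically on the range of `s`. The shift `k₀ ∈ ker φ` makes the
  -- slice pass through `z₀`, where `P` is nonzero.
  set k₀ := z₀ - s (φ z₀) with hk₀
  have hk₀B : k₀ ∈ B := hz₀
  have hσd : Differentiable ℂ fun y => s y + k₀ :=
    (LinearMap.toContinuousLinearMap s).differentiable.add (differentiable_const _)
  have hbd : Differentiable ℂ fun y => P (s y + k₀) := h.den.comp hσd
  refine ⟨n, L, fun y => F (s y + k₀), fun y => P (s y + k₀), hL, ?_, ?_, ?_, ?_⟩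
  · refine analyticAt_of_differentiableOn (U := (fun y => s y + k₀) ⁻¹' B)
      (h.isOpen.preimage hσd.continuous)
      (h.num.comp hσd.differentiableOn fun y hy => hy) (by simpa using hk₀B)
  · exact analyticAt_of_differentiableOn isOpen_univ hbd.differentiableOn (Set.mem_univ _)
  · intro hev
    have hφd : Differentiable ℂ φ := (LinearMap.toContinuousLinearMap φ).differentiable
    have han : AnalyticOnNhd ℂ (fun z => P (s (φ z) + k₀)) Set.univ := fun z _ =>
      analyticAt_of_differentiableOn isOpen_univ (hbd.comp hφd).differentiableOn (Set.mem_univ _)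
    have := han.eqOn_zero_of_preconnected_of_eventuallyEq_zero isPreconnected_univ
      (Set.mem_univ 0) hev (Set.mem_univ z₀)
    simp [hk₀] at this
    exact hP this
  · refine Germ.coe_eq.2 ?_
    have hc2 : Continuous fun z => s (φ z) + k₀ := by fun_prop
    have hev : ∀ᶠ z in 𝓝 (0 : V k), z ∈ B ∧ s (φ z) + k₀ ∈ B :=
      Filter.Eventually.and (h.isOpen.mem_nhds h.zero_mem) (
        (h.isOpen.preimage hc2).mem_nhds (by simpa using hk₀B))
    filter_upwards [offHyperplanes_le_nhds hev, h.ne_zero] with z hz hPz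
    have hw : s (φ z) + k₀ - z ∈ h.invariants := by
      refine hker _ ?_
      simp [hk₀, hs]
    have := hw z hz.1 1 (by simpa using hz.2)
    simp only [one_smul, add_sub_cancel] at this
    change F z / P z * P (s (φ z) + k₀) = F (s (φ z) + k₀)
    rw [div_mul_eq_mul_div, div_eq_iff hPz, this]

theorem dep_eq (h : IsFraction B F P) :
    Dep ((fun z => F z / P z : V k → ℂ) : GermAt (V k)) = h.invariants.dualAnnihilator :=
  le_antisymm (sInf_le h.dependsOn_dualAnnihilator)
    (le_sInf fun _ hW => h.dualAnnihilator_le_of_dependsOn hW)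

end IsFraction

/-! ### The polar semigroups -/

section Polar

variable {k : ℕ} {𝓛 : Set (Module.Dual ℂ (V k))} {P : V k → ℂ}

theorem polarSemigroup_differentiable (hP : P ∈ polarSemigroup 𝓛) : Differentiable ℂ P := by
  induction hP using Subsemigroup.closure_induction with
  | mem _ hx =>
    obtain ⟨L, -, rfl⟩ := hx
    exact (LinearMap.toContinuousLinearMap L).differentiable
  | mul x y _ _ hx hy => exact hx.mul hy

theorem polarSemigroup_real (h𝓛 : IsGeneratingSet 𝓛) (hP : P ∈ polarSemigroup 𝓛)
    (x : Fin k → ℝ) : (P (ofRealVec x)).im = 0 := by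
  induction hP using Subsemigroup.closure_induction with
  | mem _ hx =>
    obtain ⟨L, hL, rfl⟩ := hx
    exact h𝓛.real L hL x
  | mul p q _ _ hp hq => simp [hp, hq]

theorem polarSemigroup_ne_zero (h𝓛 : IsGeneratingSet 𝓛) (hP : P ∈ polarSemigroup 𝓛) :
    ∀ᶠ z in offHyperplanes (V k), P z ≠ 0 := by
  induction hP using Subsemigroup.closure_induction with
  | mem _ hx =>
    obtain ⟨L, hL, rfl⟩ := hx
    have hne : LinearMap.toContinuousLinearMap L ≠ 0 := by
      simpa using h𝓛.ne_zero L hL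
    have : offHyperplanes (V k) ≤ 𝓟 {z | LinearMap.toContinuousLinearMap L z ≠ 0} :=
      inf_le_right.trans (iInf₂_le (LinearMap.toContinuousLinearMap L) hne)
    exact this (mem_principal_self _)
  | mul p q _ _ hp hq =>
    filter_upwards [hp, hq] with z hz hz'
    exact mul_ne_zero hz hz'

theorem polarSemigroup_countable (h𝓛 : IsGeneratingSet 𝓛) : Countable (polarSemigroup 𝓛) := by
  have := h𝓛.countable.to_subtype
  have hsub : (polarSemigroup 𝓛 : Set (V k → ℂ)) ⊆
      Set.range fun l : List 𝓛 => (l.map fun L => (L.1 : V k → ℂ)).prod := by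
    intro P hP
    induction hP using Subsemigroup.closure_induction with
    | mem _ hx =>
      obtain ⟨L, hL, rfl⟩ := hx
      exact ⟨[⟨L, hL⟩], by simp⟩
    | mul p q _ _ hp hq =>
      obtain ⟨l, rfl⟩ := hp
      obtain ⟨l', rfl⟩ := hq
      exact ⟨l ++ l', by simp⟩
  exact ((Set.countable_range _).mono hsub).to_subtype

theorem polarSemigroup_comp_pr {𝓛' : Set (Module.Dual ℂ (V (k + 1)))}
    (h : ∀ L ∈ 𝓛, L ∘ₗ pr k ∈ 𝓛') (hP : P ∈ polarSemigroup 𝓛) :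
    (fun z => P (pr k z)) ∈ polarSemigroup 𝓛' := by
  induction hP using Subsemigroup.closure_induction with
  | mem _ hx =>
    obtain ⟨L, hL, rfl⟩ := hx
    exact Subsemigroup.subset_closure ⟨_, h L hL, rfl⟩
  | mul p q _ _ hp hq => exact mul_mem hp hq

theorem isFraction_of_mem (Q : RealInner k) (h𝓛 : IsGeneratingSet 𝓛) {r : ℝ} (hr : 0 < r)
    (f : BHol (Q.ball r)) (hP : P ∈ polarSemigroup 𝓛) :
    IsFraction (Q.ball r) (extZero f.1) P where
  isOpen := Q.isOpen_ball r
  convex := Q.convex_ball hr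
  zero_mem := Q.zero_mem_ball hr
  num := f.2.1
  den := polarSemigroup_differentiable hP
  ne_zero := polarSemigroup_ne_zero h𝓛 hP

end Polar

/-! ### Montel's theorem -/

theorem extZero_of_mem {k : ℕ} {B : Set (V k)} (f : B → ℂ) {z : V k} (hz : z ∈ B) :
    extZero f z = f ⟨z, hz⟩ := by simp [extZero, hz]

theorem isClosed_BHol {k : ℕ} {B : Set (V k)} (hB : IsOpen B) :
    IsClosed (BHol B : Set (B →ᵇ ℂ)) := by
  refine IsSeqClosed.isClosed fun F f hF hf => ⟨?_, fun x hx => ?_⟩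
  · refine differentiableOn_of_tendstoUniformlyOn (F := fun n => extZero (F n)) (l := atTop) hB
      (fun n => (hF n).1) ?_
    rw [tendstoUniformlyOn_iff_tendstoUniformly_comp_coe]
    have e : ∀ g : B → ℂ, extZero g ∘ ((↑) : B → V k) = g := fun g => by
      funext z; simp [extZero_of_mem _ z.2]
    have := BoundedContinuousFunction.tendsto_iff_tendstoUniformly.1 hf
    simpa only [Function.comp_def, extZero_of_mem _ (Subtype.prop _)] using this
  · have h1 : Tendsto (fun n => (F n ⟨ofRealVec x, hx⟩).im) atTop (𝓝 (f ⟨ofRealVec x, hx⟩).im) :=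
      (Complex.continuous_im.tendsto _).comp
        ((continuous_eval_const (F := B →ᵇ ℂ) _).tendsto _ |>.comp hf)
    refine tendsto_nhds_unique h1 ?_
    simp [fun n => (hF n).2 x hx]

/-- Arzelà–Ascoli. Equicontinuity comes from the Schwarz lemma: values of `f` in the unit ball
differ by at most `2`, which gives the modulus `2 / ρ * dist y x` on a ball of radius `ρ` inside
`B`. -/
theorem isCompact_closure_restriction {k : ℕ} {B C : Set (V k)} (hB : IsOpen B) (hC : IsCompact C)
    (hCB : C ⊆ B) : IsCompact (closure ((fun f : B →ᵇ ℂ => f.compContinuous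
      ⟨Set.inclusion hCB, continuous_inclusion hCB⟩) '' {f | f ∈ BHol B ∧ ‖f‖ ≤ 1})) := by
  have := isCompact_iff_compactSpace.1 hC
  refine BoundedContinuousFunction.arzela_ascoli (Metric.closedBall 0 1)
    (isCompact_closedBall 0 1) _ ?_ ?_
  · rintro _ x ⟨f, hf, rfl⟩
    rw [mem_closedBall_zero_iff]
    exact (f.norm_coe_le_norm _).trans hf.2
  · intro x
    obtain ⟨ρ, hρ, hρB⟩ := Metric.isOpen_iff.1 hB x.1 (hCB x.2)
    refine Metric.equicontinuousAt_of_continuity_modulus (fun y => 2 / ρ * dist y x) ?_ _ ?_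
    · have : Continuous fun y : C => 2 / ρ * dist y x := by fun_prop
      simpa using this.tendsto x
    · filter_upwards [Metric.ball_mem_nhds x hρ] with y hy
      rintro ⟨_, f, hf, rfl⟩
      have hy' : y.1 ∈ Metric.ball x.1 ρ := hy
      have h1 := Complex.dist_le_div_mul_dist_of_mapsTo_ball (R₂ := 2) (hf.1.1.mono hρB) (by
        intro z hz
        rw [Metric.mem_closedBall, extZero_of_mem _ (hρB hz), extZero_of_mem _ (hCB x.2)]
        refine (dist_le_norm_add_norm _ _).trans ?_
        have h2 := (f.norm_coe_le_norm ⟨z, hρB hz⟩).trans hf.2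
        have h3 := (f.norm_coe_le_norm ⟨x, hCB x.2⟩).trans hf.2
        linarith) hy'
      rw [extZero_of_mem _ (hρB hy'), extZero_of_mem _ (hCB x.2)] at h1
      rw [dist_comm]
      exact h1

/-- Pull-back along a linear map which shrinks the domain, followed by multiplication with a fixed
function, is a compact operator between spaces of bounded holomorphic functions. -/
theorem exists_compact_pullback {k k' : ℕ} {B C : Set (V k)} {B' : Set (V k')} (hB : IsOpen B)
    (hC : IsCompact C) (hCB : C ⊆ B) (hB' : IsOpen B') (p : V k' →ₗ[ℂ] V k)
    (hp : ∀ z ∈ B', p z ∈ C) (hpreal : ∀ x, ∃ y, p (ofRealVec x) = ofRealVec y)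
    (S : V k' → ℂ) (hS : Differentiable ℂ S) (hSB : ∃ M, ∀ z ∈ B', ‖S z‖ ≤ M)
    (hSreal : ∀ x, (S (ofRealVec x)).im = 0) :
    ∃ T : BHol B →L[ℝ] BHol B', (∃ K, IsCompact K ∧ ∀ f, ‖f‖ ≤ 1 → T f ∈ K) ∧
      ∀ f, ∀ z ∈ B', extZero (T f).1 z = extZero f.1 (p z) * S z := by
  obtain ⟨M, hM⟩ := hSB
  let Sb : B' →ᵇ ℂ := BoundedContinuousFunction.ofNormedAddCommGroup (fun z => S z.1)
    (hS.continuous.comp continuous_subtype_val) M fun z => hM z z.2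
  have hpc : Continuous p := p.continuous_of_finiteDimensional
  let pC : C(B', C) := ⟨fun z => ⟨p z, hp z z.2⟩, by fun_prop⟩
  -- The operator factors through restriction to `C`, which is where compactness arises.
  let ι : C(C, B) := ⟨Set.inclusion hCB, continuous_inclusion hCB⟩
  have hbound : ∀ g : C →ᵇ ℂ, ‖g.compContinuous pC * Sb‖ ≤ ‖Sb‖ * ‖g‖ := fun g => by
    rw [mul_comm ‖Sb‖]
    refine (norm_mul_le _ _).trans (mul_le_mul_of_nonneg_right ?_ (norm_nonneg _))
    exact (BoundedContinuousFunction.norm_le (norm_nonneg _)).2 fun z => g.norm_coe_le_norm _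
  let Ψ : (C →ᵇ ℂ) →L[ℝ] (B' →ᵇ ℂ) := LinearMap.mkContinuous
    { toFun := fun g => g.compContinuous pC * Sb
      map_add' := fun g g' => by ext; simp [add_mul]
      map_smul' := fun c g => by ext; simp [mul_assoc] } ‖Sb‖ hbound
  let ρ : (B →ᵇ ℂ) →L[ℝ] (C →ᵇ ℂ) := LinearMap.mkContinuous
    { toFun := fun g => g.compContinuous ι
      map_add' := fun g g' => by ext; simp
      map_smul' := fun c g => by ext; simp } 1 fun g => by
        rw [one_mul]
        exact (BoundedContinuousFunction.norm_le (norm_nonneg _)).2 fun z => g.norm_coe_le_norm _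
  have hval : ∀ (f : B →ᵇ ℂ) (z : V k') (hz : z ∈ B'),
      Ψ (ρ f) ⟨z, hz⟩ = f ⟨p z, hCB (hp z hz)⟩ * S z := fun f z hz => rfl
  have hval' : ∀ (f : B →ᵇ ℂ) (z : V k'), z ∈ B' →
      extZero (Ψ (ρ f)) z = extZero f (p z) * S z := fun f z hz => by
    rw [extZero_of_mem _ hz, extZero_of_mem _ (hCB (hp z hz)), hval]
  have hmem : ∀ f : BHol B, Ψ (ρ f.1) ∈ BHol B' := by
    intro f
    refine ⟨?_, fun x hx => ?_⟩
    · have hd : DifferentiableOn ℂ (fun z => extZero f.1 (p z) * S z) B' :=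
        (f.2.1.comp (LinearMap.toContinuousLinearMap p).differentiable.differentiableOn
          fun z hz => hCB (hp z hz)).mul hS.differentiableOn
      exact hd.congr fun z hz => hval' f.1 z hz
    · rw [hval]
      obtain ⟨y, hy⟩ := hpreal x
      have hyB : ofRealVec y ∈ B := hy ▸ hCB (hp _ hx)
      have h1 := f.2.2 y hyB
      simp only [hy, Complex.mul_im, h1, hSreal, mul_zero, zero_mul, add_zero]
  let T : BHol B →L[ℝ] BHol B' := ((Ψ.comp ρ).comp (BHol B).subtypeL).codRestrict (BHol B') hmem
  refine ⟨T, ⟨Subtype.val ⁻¹' (Ψ '' closure (ρ '' {f | f ∈ BHol B ∧ ‖f‖ ≤ 1})), ?_, ?_⟩,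
    fun f z hz => hval' f.1 z hz⟩
  · exact (isClosed_BHol hB').isClosedEmbedding_subtypeVal.isCompact_preimage
      ((isCompact_closure_restriction hB hC hCB).image Ψ.continuous)
  · exact fun f hf => ⟨ρ f.1, subset_closure ⟨f.1, ⟨f.2, hf⟩, rfl⟩, rfl⟩

/-! ### Closedness in the steps -/

/-- Numerator and direction may vary together: `B` is open, so `z + t • v n` is eventually in `B`,
and uniform convergence allows evaluation at moving points. -/
theorem invariantDir_of_tendsto {k : ℕ} {B : Set (V k)} (hB : IsOpen B) {P : V k → ℂ}
    (hP : Continuous P) {F : ℕ → BHol B} {f : BHol B} (hF : Tendsto F atTop (𝓝 f))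
    {v : ℕ → V k} {w : V k} (hv : Tendsto v atTop (𝓝 w))
    (h : ∀ n, InvariantDir B (extZero (F n).1) P (v n)) : InvariantDir B (extZero f.1) P w := by
  intro z hz t ht
  have h1 : Tendsto (fun n => z + t • v n) atTop (𝓝 (z + t • w)) :=
    tendsto_const_nhds.add (hv.const_smul t)
  have hev := h1.eventually_mem (hB.mem_nhds ht)
  have hF' : TendstoUniformlyOn (fun n => extZero (F n).1) (extZero f.1) atTop B := by
    rw [tendstoUniformlyOn_iff_tendstoUniformly_comp_coe]
    have := BoundedContinuousFunction.tendsto_iff_tendstoUniformly.1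
      ((continuous_subtype_val.tendsto f).comp hF)
    simpa only [Function.comp_def, extZero_of_mem _ (Subtype.prop _)] using this
  have h2 : Tendsto (fun n => extZero (F n).1 (z + t • v n)) atTop (𝓝 (extZero f.1 (z + t • w))) :=
    hF'.tendsto_comp (f.2.1.continuousOn _ ht)
      (tendsto_nhdsWithin_iff.2 ⟨h1, hev⟩)
  have h3 : Tendsto (fun n => extZero (F n).1 z) atTop (𝓝 (extZero f.1 z)) := hF'.tendsto_at hz
  have h4 : Tendsto (fun n => P (z + t • v n)) atTop (𝓝 (P (z + t • w))) :=
    (hP.tendsto _).comp h1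
  refine tendsto_nhds_unique_of_eventuallyEq (h2.mul_const (P z)) (h3.mul h4) ?_
  filter_upwards [hev] with n hn
  exact h n z hz t hn

theorem dep_meroStep {k : ℕ} (Q : RealInner k) {𝓛 : Set (Module.Dual ℂ (V k))}
    (h𝓛 : IsGeneratingSet 𝓛) (i : ℕ × polarSemigroup 𝓛)
    (f : BHol (Q.ball (1 / ((i.1 : ℝ) + 1)))) :
    Dep (meroStep Q 𝓛 i f) =
      (isFraction_of_mem Q h𝓛 Nat.one_div_pos_of_nat f i.2.2).invariants.dualAnnihilator :=
  (isFraction_of_mem Q h𝓛 Nat.one_div_pos_of_nat f i.2.2).dep_eq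

theorem isClosed_perp_step {k : ℕ} (Q : RealInner k) {𝓛 : Set (Module.Dual ℂ (V k))}
    (h𝓛 : IsGeneratingSet 𝓛) (i : ℕ × polarSemigroup 𝓛) :
    IsClosed {e : BHol (Q.ball (1 / ((i.1 : ℝ) + 1))) × BHol (Q.ball (1 / ((i.1 : ℝ) + 1))) |
      Q.Perp (Dep (meroStep Q 𝓛 i e.1)) (Dep (meroStep Q 𝓛 i e.2))} := by
  simp only [dep_meroStep Q h𝓛, RealInner.perp_dualAnnihilator_iff]
  refine IsSeqClosed.isClosed fun x y hx hxy v => ?_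
  choose a ha hb hab using fun n => hx n v
  -- Pythagoras keeps the components `a n` in a compact set.
  have hsq : ∀ n, Q.sq (a n) ≤ Q.sq v := fun n => by
    have := Q.sq_add_of_form_eq_zero (hab n)
    rw [add_sub_cancel] at this
    linarith [Q.sq_nonneg (v - a n)]
  obtain ⟨w, -, φ, hφ, hw⟩ := (Q.isCompact_sq_le (Q.sq v)).tendsto_subseq hsq
  have hB := Q.isOpen_ball (1 / ((i.1 : ℝ) + 1))
  have hP := (polarSemigroup_differentiable i.2.2).continuous
  have hlim := hxy.comp hφ.tendsto_atTop
  have hvw : Tendsto (fun n => v - a (φ n)) atTop (𝓝 (v - w)) := tendsto_const_nhds.sub hw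
  refine ⟨w, ?_, ?_, ?_⟩
  · exact invariantDir_of_tendsto hB hP ((continuous_fst.tendsto y).comp hlim) hw
      fun n => ha (φ n)
  · exact invariantDir_of_tendsto hB hP ((continuous_snd.tendsto y).comp hlim) hvw
      fun n => hb (φ n)
  · refine tendsto_nhds_unique ((Q.continuous_form.tendsto _).comp (hw.prodMk_nhds hvw)) ?_
    simp [Function.comp_def, fun n => hab (φ n)]

/-! ### The steps of the inductive limits -/

theorem Seminorm.continuous_of_le_mul_norm {E : Type*} [NormedAddCommGroup E] [NormedSpace ℝ E]
    {p : Seminorm ℝ E} {C : ℝ} (h : ∀ e, p e ≤ C * ‖e‖) : Continuous p := by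
  refine Seminorm.continuous_of_continuousAt_zero ?_
  have h1 : Tendsto (fun e : E => C * ‖e‖) (𝓝 0) (𝓝 0) := by
    have : Continuous fun e : E => C * ‖e‖ := by fun_prop
    simpa using this.tendsto 0
  rw [ContinuousAt, map_zero]
  exact squeeze_zero (fun e => apply_nonneg p e) h h1

theorem lcLimit.exists_incl_eq {ι : Type} {E : ι → Type} [∀ i, AddCommGroup (E i)]
    [∀ i, Module ℝ (E i)] {G : Type} [AddCommGroup G] [Module ℝ G] [Nonempty ι]
    (u : ∀ i, E i →ₗ[ℝ] G) (h : Directed (· ≤ ·) fun i => LinearMap.range (u i)) (x : lcLimit u) :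
    ∃ i e, lcLimit.incl u i e = x := by
  obtain ⟨i, e, he⟩ := (Submodule.mem_iSup_of_directed _ h).1 x.2
  exact ⟨i, e, Subtype.ext he⟩

/-- Needed for the degenerate case: denominators have at least one factor, so an empty `𝓛` leaves no
steps and the limit is zero. -/
theorem lcLimit.subsingleton {ι : Type} {E : ι → Type} [∀ i, AddCommGroup (E i)]
    [∀ i, Module ℝ (E i)] {G : Type} [AddCommGroup G] [Module ℝ G]
    (u : ∀ i, E i →ₗ[ℝ] G) (h : ∀ i, u i = 0) : Subsingleton (lcLimit u) := by
  have : lcLimit u = ⊥ := by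
    simp [lcLimit, h]
  rw [this]
  infer_instance

theorem RealInner.exists_compact_pullback_ball {k k' : ℕ} (Q : RealInner k) (Q' : RealInner k')
    (p : V k' →ₗ[ℂ] V k) (hp : ∀ z, Q.sq (p z) ≤ Q'.sq z)
    (hpreal : ∀ x, ∃ y, p (ofRealVec x) = ofRealVec y) (S : V k' → ℂ) (hS : Differentiable ℂ S)
    (hSreal : ∀ x, (S (ofRealVec x)).im = 0) {m m' : ℕ} (hm : m < m') :
    ∃ T : BHol (Q.ball (1 / ((m : ℝ) + 1))) →L[ℝ] BHol (Q'.ball (1 / ((m' : ℝ) + 1))),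
      (∃ K, IsCompact K ∧ ∀ f, ‖f‖ ≤ 1 → T f ∈ K) ∧
      ∀ f, ∀ z ∈ Q'.ball (1 / ((m' : ℝ) + 1)),
        extZero (T f).1 z = extZero f.1 (p z) * S z := by
  have hr : (0 : ℝ) < 1 / ((m : ℝ) + 1) := Nat.one_div_pos_of_nat
  have hr' : (0 : ℝ) < 1 / ((m' : ℝ) + 1) := Nat.one_div_pos_of_nat
  have hlt : (1 : ℝ) / ((m' : ℝ) + 1) < 1 / ((m : ℝ) + 1) := Nat.one_div_lt_one_div hm
  refine exists_compact_pullback (C := {z | Q.sq z ≤ (1 / ((m' : ℝ) + 1)) ^ 2}) (Q.isOpen_ball _)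
    (Q.isCompact_sq_le _) (fun z hz => ?_) (Q'.isOpen_ball _) p (fun z hz => ?_) hpreal S hS ?_
    hSreal
  · rw [Q.mem_ball hr]
    exact lt_of_le_of_lt hz (pow_lt_pow_left₀ hlt hr'.le two_ne_zero)
  · exact (hp z).trans ((Q'.mem_ball hr').1 hz).le
  · obtain ⟨M, hM⟩ := (Q'.isCompact_sq_le ((1 / ((m' : ℝ) + 1)) ^ 2)).exists_bound_of_continuousOn
      hS.continuous.continuousOn
    exact ⟨M, fun z hz => hM z ((Q'.mem_ball hr').1 hz).le⟩

section Mero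

variable {k : ℕ} (Q : RealInner k) {𝓛 : Set (Module.Dual ℂ (V k))}

/-- The map is `f / P = (f * P') / (P * P')`, restricted to a strictly smaller ball. -/
theorem compactStep_mero (h𝓛 : IsGeneratingSet 𝓛) {m m' : ℕ} (hm : m < m')
    (P P' R : polarSemigroup 𝓛) (hR : ∀ z, R.1 z = P.1 z * P'.1 z) :
    CompactStep (lcLimit.incl (meroStep Q 𝓛)) (m, P) (m', R) := by
  obtain ⟨T, hT, hTS⟩ := Q.exists_compact_pullback_ball Q LinearMap.id (fun z => le_rfl)
    (fun x => ⟨x, rfl⟩) P'.1 (polarSemigroup_differentiable P'.2) (polarSemigroup_real h𝓛 P'.2) hm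
  refine ⟨T, hT, fun e => Subtype.ext (Germ.coe_eq.2 ?_)⟩
  have hB : ∀ᶠ z in offHyperplanes (V k), z ∈ Q.ball (1 / ((m' : ℝ) + 1)) :=
    offHyperplanes_le_nhds ((Q.isOpen_ball _).mem_nhds (Q.zero_mem_ball Nat.one_div_pos_of_nat))
  filter_upwards [hB, polarSemigroup_ne_zero h𝓛 P'.2] with z hz hP'
  rw [hTS e z hz, hR z]
  exact mul_div_mul_right _ _ hP'

theorem directed_mero (h𝓛 : IsGeneratingSet 𝓛) :
    Directed (CompactStep (lcLimit.incl (meroStep Q 𝓛))) id := by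
  rintro ⟨m, P⟩ ⟨m', P'⟩
  refine ⟨(max m m' + 1, P * P'), compactStep_mero Q h𝓛 (by omega) P P' _ fun z => rfl,
    compactStep_mero Q h𝓛 (by omega) P' P _ fun z => mul_comm _ _⟩

theorem exists_meroStep_eq [Nonempty (polarSemigroup 𝓛)] (h𝓛 : IsGeneratingSet 𝓛) (x : Mero Q 𝓛) :
    ∃ i e, lcLimit.incl (meroStep Q 𝓛) i e = x := by
  refine lcLimit.exists_incl_eq _ (fun i j => ?_) x
  obtain ⟨l, ⟨T, -, hT⟩, ⟨T', -, hT'⟩⟩ := directed_mero Q h𝓛 i j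
  refine ⟨l, ?_, ?_⟩
  · rintro _ ⟨e, rfl⟩
    exact ⟨T e, congrArg Subtype.val (hT e)⟩
  · rintro _ ⟨e, rfl⟩
    exact ⟨T' e, congrArg Subtype.val (hT' e)⟩

theorem subsingleton_mero [IsEmpty (polarSemigroup 𝓛)] : Subsingleton (Mero Q 𝓛) :=
  lcLimit.subsingleton _ fun i => isEmptyElim i.2

instance : IsTopologicalAddGroup (Mero Q 𝓛) := lcLimit.isTopologicalAddGroup (meroStep Q 𝓛)

theorem continuous_seminorm_mero (p : Seminorm ℝ (Mero Q 𝓛))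
    (hp : ∀ i, ∃ C, ∀ e, p (lcLimit.incl (meroStep Q 𝓛) i e) ≤ C * ‖e‖) : Continuous p :=
  lcLimit.continuous_seminorm (meroStep Q 𝓛) p fun i =>
    Seminorm.continuous_of_le_mul_norm (p := p.comp (lcLimit.incl (meroStep Q 𝓛) i)) (hp i).choose_spec

theorem isClosed_perpRel (h𝓛 : IsGeneratingSet 𝓛) : IsClosed (perpRel Q 𝓛) := by
  rcases isEmpty_or_nonempty (polarSemigroup 𝓛) with he | hne
  · have := subsingleton_mero Q (𝓛 := 𝓛)
    exact (Set.Subsingleton.finite fun x _ y _ => Subsingleton.elim x y).isClosed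
  · have := polarSemigroup_countable h𝓛
    exact isClosed_of_isClosed_steps (X := Mero Q 𝓛) (lcLimit.incl (meroStep Q 𝓛)) (directed_mero Q h𝓛)
      (exists_meroStep_eq Q h𝓛) (continuous_seminorm_mero Q) _ (isClosed_perp_step Q h𝓛)

end Mero

/-! ### Dependence on further variables -/

section Pull

variable {k : ℕ}

theorem pr_inc (v : V k) : pr k (inc v) = v := by
  ext i; simp [pr, inc, LinearMap.funLeft]

theorem continuous_inc : Continuous (inc : V k → V (k + 1)) :=
  Continuous.finSnoc continuous_id continuous_const

theorem inc_zero : inc (0 : V k) = 0 := by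
  ext i
  refine Fin.lastCases ?_ (fun j => ?_) i <;> simp [inc]

/-- Compatibility of inner products with the inclusions and projections. -/
structure Compatible (Q : RealInner k) (Q' : RealInner (k + 1)) : Prop where
  form_inc : ∀ v w, Q'.form (inc v) (inc w) = Q.form v w
  riesz_pr : ∀ L, Q'.riesz (L ∘ₗ pr k) = inc (Q.riesz L)

namespace Compatible

variable {Q : RealInner k} {Q' : RealInner (k + 1)} (h : Compatible Q Q')
include h

/-- The condition on `L^*`, read for `L = Q(·, w)`, says that `inc` is the adjoint of `pr`; hence
`inc ∘ pr` is an orthogonal projection. -/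
theorem form_inc_right (z : V (k + 1)) (w : V k) : Q'.form z (inc w) = Q.form (pr k z) w := by
  let L : Module.Dual ℂ (V k) := Q.form.flip w
  have h1 : Q.riesz L = w := Q.riesz_eq fun z => rfl
  have h2 := Q'.riesz_spec (L ∘ₗ pr k) z
  rw [h.riesz_pr, h1] at h2
  exact h2.symm

theorem sq_pr_le (z : V (k + 1)) : Q.sq (pr k z) ≤ Q'.sq z := by
  have h1 : Q'.form (z - inc (pr k z)) (inc (pr k z)) = 0 := by
    rw [h.form_inc_right, map_sub, pr_inc, sub_self, map_zero, LinearMap.zero_apply]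
  have h2 := Q'.sq_add_of_form_eq_zero h1
  have h3 : Q'.sq (inc (pr k z)) = Q.sq (pr k z) := by
    simp only [RealInner.sq, h.form_inc]
  rw [sub_add_cancel, h3] at h2
  linarith [Q'.sq_nonneg (z - inc (pr k z))]

theorem perp_comap_iff (K K' : Submodule ℂ (V k)) :
    Q'.Perp (K.comap (pr k)).dualAnnihilator (K'.comap (pr k)).dualAnnihilator ↔
      Q.Perp K.dualAnnihilator K'.dualAnnihilator := by
  constructor
  · intro hp L hL L' hL'
    rw [Submodule.mem_dualAnnihilator] at hL hL'
    have := hp (L ∘ₗ pr k) ((Submodule.mem_dualAnnihilator _).2 fun z hz => hL _ hz)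
      (L' ∘ₗ pr k) ((Submodule.mem_dualAnnihilator _).2 fun z hz => hL' _ hz)
    rwa [RealInner.dual, h.riesz_pr, h.riesz_pr, h.form_inc] at this
  · rw [RealInner.perp_dualAnnihilator_iff, RealInner.perp_dualAnnihilator_iff]
    intro hp z
    obtain ⟨a, ha, hb, hab⟩ := hp (pr k z)
    -- A splitting of `pr k z` lifts to one of `z`, with the last coordinate absorbed by the second
    -- summand.
    refine ⟨inc a, by simpa [pr_inc] using ha, by simpa [pr_inc] using hb, ?_⟩
    refine Q'.form_eq_zero_symm ?_
    rw [h.form_inc_right, map_sub, pr_inc]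
    exact Q.form_eq_zero_symm hab

theorem exists_pull (m : ℕ) :
    ∃ T : BHol (Q.ball (1 / ((m : ℝ) + 1))) →L[ℝ] BHol (Q'.ball (1 / (((m + 1 : ℕ) : ℝ) + 1))),
      (∃ K, IsCompact K ∧ ∀ f, ‖f‖ ≤ 1 → T f ∈ K) ∧
      ∀ f, ∀ z ∈ Q'.ball (1 / (((m + 1 : ℕ) : ℝ) + 1)),
        extZero (T f).1 z = extZero f.1 (pr k z) := by
  obtain ⟨T, hT, hTS⟩ := Q.exists_compact_pullback_ball Q' (pr k) h.sq_pr_le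
    (fun x => ⟨fun i => x i.castSucc, rfl⟩) (fun _ => 1) (differentiable_const _) (fun _ => rfl)
    (Nat.lt_succ_self m)
  exact ⟨T, hT, fun f z hz => by rw [hTS f z hz, mul_one]⟩

theorem pr_mem_ball {m : ℕ} {z : V (k + 1)} (hz : z ∈ Q'.ball (1 / (((m + 1 : ℕ) : ℝ) + 1))) :
    pr k z ∈ Q.ball (1 / ((m : ℝ) + 1)) := by
  rw [Q'.mem_ball Nat.one_div_pos_of_nat] at hz
  rw [Q.mem_ball Nat.one_div_pos_of_nat]
  refine (h.sq_pr_le z).trans_lt (hz.trans ?_)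
  exact pow_lt_pow_left₀ (Nat.one_div_lt_one_div (Nat.lt_succ_self m))
    (Nat.one_div_pos_of_nat (α := ℝ)).le two_ne_zero

/-- Directions of invariance of a quotient which does not depend on the last variable. -/
theorem invariants_pull {m : ℕ} {F P : V k → ℂ} {F' : V (k + 1) → ℂ}
    (hF : IsFraction (Q.ball (1 / ((m : ℝ) + 1))) F P)
    (hF' : IsFraction (Q'.ball (1 / (((m + 1 : ℕ) : ℝ) + 1))) F' fun z => P (pr k z))
    (hFF' : ∀ z ∈ Q'.ball (1 / (((m + 1 : ℕ) : ℝ) + 1)), F' z = F (pr k z)) :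
    hF'.invariants = hF.invariants.comap (pr k) := by
  ext v
  rw [Submodule.mem_comap, IsFraction.mem_invariants, IsFraction.mem_invariants]
  constructor
  · intro hv
    refine hF.invariantDir_of_eventually hF.zero_mem ?_
    have h1 : Tendsto (fun p : V k × ℂ => inc p.1) (𝓝 (0, 0)) (𝓝 0) := by
      simpa [inc_zero, Function.comp_def] using (continuous_inc.comp continuous_fst).tendsto ((0, 0) : V k × ℂ)
    have h2 : Tendsto (fun p : V k × ℂ => inc p.1 + p.2 • v) (𝓝 (0, 0)) (𝓝 0) := by
      have : Continuous fun p : V k × ℂ => inc p.1 + p.2 • v :=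
        (continuous_inc.comp continuous_fst).add (by fun_prop)
      simpa [inc_zero] using this.tendsto (0, 0)
    have hB := hF'.isOpen.mem_nhds hF'.zero_mem
    filter_upwards [h1.eventually_mem hB, h2.eventually_mem hB] with p hp hp'
    have := hv _ hp _ hp'
    rw [hFF' _ hp, hFF' _ hp'] at this
    simpa [pr_inc] using this
  · intro hv z hz t ht
    rw [hFF' _ hz, hFF' _ ht]
    simp only [map_add, map_smul]
    exact hv _ (h.pr_mem_ball hz) t (by simpa using h.pr_mem_ball ht)

end Compatible

theorem dep_zero : Dep (0 : GermAt (V k)) = ⊥ := by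
  refine eq_bot_iff.2 (sInf_le ⟨0, fun i => i.elim0, fun _ => 0, fun _ => 1, by simp,
    analyticAt_const, analyticAt_const, fun h => ?_, ?_⟩)
  · simpa using h.self_of_nhds
  · exact zero_mul _

theorem RealInner.perp_bot (Q : RealInner k) : Q.Perp ⊥ ⊥ := by
  intro w _ w' hw'
  rw [(Submodule.mem_bot ℂ).1 hw', RealInner.dual, ← Q.riesz_spec, LinearMap.zero_apply]

end Pull

/-! ### Infinitely many variables -/

section MeroN

variable {𝓛 : ∀ k, Set (Module.Dual ℂ (V k))} (h𝓛 : ∀ k, IsGeneratingSet (𝓛 k))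
  (hpr : ∀ k, ∀ L ∈ 𝓛 k, L ∘ₗ pr k ∈ 𝓛 (k + 1)) {Q : ∀ k, RealInner k}

include h𝓛

theorem toMeroN_injective (k : ℕ) : Function.Injective (toMeroN Q 𝓛 k) := by
  refine (injective_iff_map_eq_zero _).2 fun x hx => ?_
  rcases isEmpty_or_nonempty (polarSemigroup (𝓛 k)) with he | hne
  · have := subsingleton_mero (Q k) (𝓛 := 𝓛 k)
    exact Subsingleton.elim _ _
  obtain ⟨i, e, rfl⟩ := exists_meroStep_eq (Q k) (h𝓛 k) x
  have hfr := isFraction_of_mem (Q k) (h𝓛 k) Nat.one_div_pos_of_nat e i.2.2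
  have h1 : ((fun z => extZero e.1 (prN k z) / i.2.1 (prN k z) : (ℕ → ℂ) → ℂ) :
      GermAt (ℕ → ℂ)) = ((fun _ => 0 : (ℕ → ℂ) → ℂ) : GermAt (ℕ → ℂ)) :=
    congrArg Subtype.val hx
  have h2 : ∀ᶠ z in offHyperplanes (ℕ → ℂ), extZero e.1 (prN k z) = 0 := by
    filter_upwards [Germ.coe_eq.1 h1,
      (tendsto_offHyperplanes (prN k) (prN_surjective k)).eventually hfr.ne_zero] with z hz hP
    exact (div_eq_zero_iff.1 hz).resolve_right hP
  -- Vanishing must first be extended across hyperplanes, since the slice `σ` used next lies inside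
  -- a hyperplane.
  have h3 := eventually_nhds_of_offHyperplanes (hfr.isOpen.preimage (prN k).continuous)
    (by simpa using hfr.zero_mem)
    (hfr.num.continuousOn.comp (prN k).continuous.continuousOn fun z hz => hz) h2
  have h4 : ∀ᶠ z in 𝓝 (0 : V k), extZero e.1 z = 0 := by
    let σ : V k → ℕ → ℂ := fun v j => if h : j < k then v ⟨j, h⟩ else 0
    have hσ : Continuous σ := continuous_pi fun j => by
      by_cases h : j < k
      · simpa [σ, h] using continuous_apply _
      · simpa [σ, h] using continuous_const
    have hσ0 : σ 0 = 0 := by ext j; simp [σ]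
    have hprσ : ∀ v, prN k (σ v) = v := fun v => by ext i; simp [prN, σ]
    have := (hσ.tendsto 0).eventually (by rw [hσ0]; exact h3)
    simpa [hprσ] using this
  refine Subtype.ext (Germ.coe_eq.2 ?_)
  filter_upwards [offHyperplanes_le_nhds h4] with z hz
  rw [hz]
  exact zero_div _

/-- The canonical map of a step of the inductive limit into the germs on `ℂ^ℕ`. -/
def meroNIncl (Q : ∀ k, RealInner k) (𝓛 : ∀ k, Set (Module.Dual ℂ (V k)))
    (i : Σ k, ℕ × polarSemigroup (𝓛 k)) :
    BHol ((Q i.1).ball (1 / ((i.2.1 : ℝ) + 1))) →ₗ[ℝ] MeroN Q 𝓛 :=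
  (toMeroN Q 𝓛 i.1) ∘ₗ (lcLimit.incl (meroStep (Q i.1) (𝓛 i.1)) i.2)

include hpr

variable (hcomp : ∀ k, Compatible (Q k) (Q (k + 1)))

/-- The polar divisor, regarded as a function of one more variable. -/
def pullPolar {k : ℕ} (P : polarSemigroup (𝓛 k)) : polarSemigroup (𝓛 (k + 1)) :=
  ⟨fun z => P.1 (pr k z), polarSemigroup_comp_pr (hpr k) P.2⟩

include hcomp

theorem exists_pull_step (k m : ℕ) (P : polarSemigroup (𝓛 k)) :
    ∃ T : BHol ((Q k).ball (1 / ((m : ℝ) + 1))) →L[ℝ]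
        BHol ((Q (k + 1)).ball (1 / (((m + 1 : ℕ) : ℝ) + 1))),
      (∃ K, IsCompact K ∧ ∀ f, ‖f‖ ≤ 1 → T f ∈ K) ∧
      (∀ e, meroNIncl Q 𝓛 ⟨k + 1, m + 1, pullPolar hpr P⟩ (T e) = meroNIncl Q 𝓛 ⟨k, m, P⟩ e) ∧
      ∀ e e', (Q (k + 1)).Perp (Dep (meroStep (Q (k + 1)) (𝓛 (k + 1)) (m + 1, pullPolar hpr P) (T e)))
        (Dep (meroStep (Q (k + 1)) (𝓛 (k + 1)) (m + 1, pullPolar hpr P) (T e'))) ↔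
        (Q k).Perp (Dep (meroStep (Q k) (𝓛 k) (m, P) e)) (Dep (meroStep (Q k) (𝓛 k) (m, P) e')) := by
  obtain ⟨T, hT, hTe⟩ := (hcomp k).exists_pull m
  refine ⟨T, hT, fun e => Subtype.ext (Germ.coe_eq.2 ?_), fun e e' => ?_⟩
  · have hB : ∀ᶠ z in offHyperplanes (V (k + 1)),
        z ∈ (Q (k + 1)).ball (1 / (((m + 1 : ℕ) : ℝ) + 1)) :=
      offHyperplanes_le_nhds
        (((Q (k + 1)).isOpen_ball _).mem_nhds ((Q (k + 1)).zero_mem_ball Nat.one_div_pos_of_nat))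
    filter_upwards [(tendsto_offHyperplanes (prN (k + 1)) (prN_surjective _)).eventually hB]
      with z hz
    change extZero (T e).1 (prN (k + 1) z) / P.1 (pr k (prN (k + 1) z)) =
      extZero e.1 (prN k z) / P.1 (prN k z)
    rw [hTe e _ hz]
    rfl
  · rw [dep_meroStep _ (h𝓛 _), dep_meroStep _ (h𝓛 _), dep_meroStep _ (h𝓛 _),
      dep_meroStep _ (h𝓛 _)]
    have key : ∀ e, (isFraction_of_mem (Q (k + 1)) (h𝓛 (k + 1)) Nat.one_div_pos_of_nat (T e)
        (pullPolar hpr P).2).invariants = (isFraction_of_mem (Q k) (h𝓛 k)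
        Nat.one_div_pos_of_nat e P.2).invariants.comap (pr k) := fun e =>
      (hcomp k).invariants_pull _ _ (hTe e)
    have h1 := (hcomp k).perp_comap_iff
      (isFraction_of_mem (Q k) (h𝓛 k) Nat.one_div_pos_of_nat e P.2).invariants
      (isFraction_of_mem (Q k) (h𝓛 k) Nat.one_div_pos_of_nat e' P.2).invariants
    rw [← key, ← key] at h1
    exact h1

theorem exists_pull_pair (k : ℕ) (x y : Mero (Q k) (𝓛 k)) :
    ∃ x' y' : Mero (Q (k + 1)) (𝓛 (k + 1)), toMeroN Q 𝓛 (k + 1) x' = toMeroN Q 𝓛 k x ∧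
      toMeroN Q 𝓛 (k + 1) y' = toMeroN Q 𝓛 k y ∧
      ((x', y') ∈ perpRel (Q (k + 1)) (𝓛 (k + 1)) ↔ (x, y) ∈ perpRel (Q k) (𝓛 k)) := by
  rcases isEmpty_or_nonempty (polarSemigroup (𝓛 k)) with he | hne
  · have := subsingleton_mero (Q k) (𝓛 := 𝓛 k)
    obtain rfl := Subsingleton.elim 0 x
    obtain rfl := Subsingleton.elim 0 y
    refine ⟨0, 0, by simp, by simp, iff_of_true ?_ ?_⟩
    · simpa [perpRel, dep_zero] using (Q (k + 1)).perp_bot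
    · simpa [perpRel, dep_zero] using (Q k).perp_bot
  · obtain ⟨i, e, rfl⟩ := exists_meroStep_eq (Q k) (h𝓛 k) x
    obtain ⟨j, e', rfl⟩ := exists_meroStep_eq (Q k) (h𝓛 k) y
    obtain ⟨l, ⟨T, -, hT⟩, ⟨T', -, hT'⟩⟩ := directed_mero (Q k) (h𝓛 k) i j
    obtain ⟨S, -, hS, hS'⟩ := exists_pull_step h𝓛 hpr hcomp k l.1 l.2
    refine ⟨_, _, (hS (T e)).trans (congrArg (toMeroN Q 𝓛 k) (hT e)),
      (hS (T' e')).trans (congrArg (toMeroN Q 𝓛 k) (hT' e')), (hS' (T e) (T' e')).trans ?_⟩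
    have h1 : meroStep (Q k) (𝓛 k) l (T e) = meroStep (Q k) (𝓛 k) i e := congrArg Subtype.val (hT e)
    have h2 : meroStep (Q k) (𝓛 k) l (T' e') = meroStep (Q k) (𝓛 k) j e' :=
      congrArg Subtype.val (hT' e')
    exact iff_of_eq (congrArg₂ (fun f g => (Q k).Perp (Dep f) (Dep g)) h1 h2)

theorem exists_pull_pair_of_le {k m : ℕ} (hkm : k ≤ m) (x y : Mero (Q k) (𝓛 k)) :
    ∃ x' y' : Mero (Q m) (𝓛 m), toMeroN Q 𝓛 m x' = toMeroN Q 𝓛 k x ∧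
      toMeroN Q 𝓛 m y' = toMeroN Q 𝓛 k y ∧
      ((x', y') ∈ perpRel (Q m) (𝓛 m) ↔ (x, y) ∈ perpRel (Q k) (𝓛 k)) := by
  induction m, hkm using Nat.le_induction with
  | base => exact ⟨x, y, rfl, rfl, Iff.rfl⟩
  | succ m _ ih =>
    obtain ⟨x', y', hx, hy, h⟩ := ih
    obtain ⟨x'', y'', hx', hy', h'⟩ := exists_pull_pair h𝓛 hpr hcomp m x' y'
    exact ⟨x'', y'', hx'.trans hx, hy'.trans hy, h'.trans h⟩

/-- Membership in the union may be witnessed at another level `l`. Both pairs are moved to level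
`max k l`, where injectivity identifies them, and pull-back preserves and reflects orthogonality. -/
theorem toMeroN_mem_perpRelN_iff {k : ℕ} (x y : Mero (Q k) (𝓛 k)) :
    (toMeroN Q 𝓛 k x, toMeroN Q 𝓛 k y) ∈ perpRelN Q 𝓛 ↔ (x, y) ∈ perpRel (Q k) (𝓛 k) := by
  refine ⟨fun h => ?_, fun h => Set.mem_iUnion.2 ⟨k, _, h, rfl⟩⟩
  obtain ⟨l, ⟨a, b⟩, hab, he⟩ := Set.mem_iUnion.1 h
  obtain ⟨hea, heb⟩ := Prod.ext_iff.1 he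
  obtain ⟨x', y', hx, hy, h1⟩ := exists_pull_pair_of_le h𝓛 hpr hcomp (le_max_left k l) x y
  obtain ⟨a', b', ha, hb, h2⟩ := exists_pull_pair_of_le h𝓛 hpr hcomp (le_max_right k l) a b
  have e1 : a' = x' := toMeroN_injective h𝓛 _ (by rw [ha, hx]; exact hea)
  have e2 : b' = y' := toMeroN_injective h𝓛 _ (by rw [hb, hy]; exact heb)
  rw [← h1, ← e1, ← e2, h2]
  exact hab

theorem compactStep_pull {k K : ℕ} (hK : k ≤ K) (i : ℕ × polarSemigroup (𝓛 k)) :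
    ∃ j, CompactStep (meroNIncl Q 𝓛) ⟨k, i⟩ ⟨K, j⟩ := by
  induction K, hK using Nat.le_induction with
  | base =>
    -- Even for `K = k` the step must change, because a compact map is required: the ball is shrunk.
    obtain ⟨j, ⟨T, hT, h⟩, -⟩ := directed_mero (Q k) (h𝓛 k) i i
    exact ⟨j, T, hT, fun e => congrArg (toMeroN Q 𝓛 k) (h e)⟩
  | succ K _ ih =>
    obtain ⟨⟨m, P⟩, hj⟩ := ih
    obtain ⟨S, hS, hS', -⟩ := exists_pull_step h𝓛 hpr hcomp K m P
    exact ⟨(m + 1, pullPolar hpr P), hj.trans ⟨S, hS, hS'⟩⟩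

theorem directed_meroN : Directed (CompactStep (meroNIncl Q 𝓛)) id := by
  rintro ⟨k, i⟩ ⟨k', i'⟩
  obtain ⟨j, hj⟩ := compactStep_pull h𝓛 hpr hcomp (le_max_left k k') i
  obtain ⟨j', hj'⟩ := compactStep_pull h𝓛 hpr hcomp (le_max_right k k') i'
  obtain ⟨l, ⟨T, hT, h⟩, ⟨T', hT', h'⟩⟩ := directed_mero (Q (max k k')) (h𝓛 _) j j'
  exact ⟨⟨max k k', l⟩, hj.trans ⟨T, hT, fun e => congrArg (toMeroN Q 𝓛 _) (h e)⟩,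
    hj'.trans ⟨T', hT', fun e => congrArg (toMeroN Q 𝓛 _) (h' e)⟩⟩

theorem exists_meroNIncl_eq [Nonempty (Σ k, ℕ × polarSemigroup (𝓛 k))] (x : MeroN Q 𝓛) :
    ∃ i e, meroNIncl Q 𝓛 i e = x := by
  obtain ⟨k, y, rfl⟩ := lcLimit.exists_incl_eq (meroNStep Q 𝓛) (fun k l => by
    refine ⟨max k l, ?_, ?_⟩
    · rintro _ ⟨y, rfl⟩
      obtain ⟨y', -, h, -⟩ := exists_pull_pair_of_le h𝓛 hpr hcomp (le_max_left k l) y y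
      exact ⟨y', congrArg Subtype.val h⟩
    · rintro _ ⟨y, rfl⟩
      obtain ⟨y', -, h, -⟩ := exists_pull_pair_of_le h𝓛 hpr hcomp (le_max_right k l) y y
      exact ⟨y', congrArg Subtype.val h⟩) x
  rcases isEmpty_or_nonempty (polarSemigroup (𝓛 k)) with he | hne
  · have := subsingleton_mero (Q k) (𝓛 := 𝓛 k)
    obtain ⟨i⟩ := ‹Nonempty (Σ k, ℕ × polarSemigroup (𝓛 k))›
    exact ⟨i, 0, (map_zero (meroNIncl Q 𝓛 i)).trans ((map_zero (toMeroN Q 𝓛 k)).symm.trans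
      (congrArg (toMeroN Q 𝓛 k) (Subsingleton.elim 0 y)))⟩
  · obtain ⟨i, e, rfl⟩ := exists_meroStep_eq (Q k) (h𝓛 k) y
    exact ⟨⟨k, i⟩, e, rfl⟩

theorem isClosed_perpRelN : IsClosed (perpRelN Q 𝓛) := by
  have : IsTopologicalAddGroup (MeroN Q 𝓛) := lcLimit.isTopologicalAddGroup (meroNStep Q 𝓛)
  rcases isEmpty_or_nonempty (Σ k, ℕ × polarSemigroup (𝓛 k)) with he | hne
  · have : Subsingleton (MeroN Q 𝓛) := lcLimit.subsingleton _ fun k => by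
      have : IsEmpty (polarSemigroup (𝓛 k)) := ⟨fun P => he.elim ⟨k, 0, P⟩⟩
      have := subsingleton_mero (Q k) (𝓛 := 𝓛 k)
      ext x
      rw [Subsingleton.elim x 0, map_zero, map_zero]
    exact (Set.Subsingleton.finite fun x _ y _ => Subsingleton.elim x y).isClosed
  · have := fun k => polarSemigroup_countable (h𝓛 k)
    -- The iterated limit is treated as one countable limit over triples of level, radius and
    -- denominator; continuity of seminorms passes through the two stages in turn.
    refine isClosed_of_isClosed_steps (X := MeroN Q 𝓛) (meroNIncl Q 𝓛)
      (directed_meroN h𝓛 hpr hcomp) (exists_meroNIncl_eq h𝓛 hpr hcomp) (fun p hp => ?_) _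
      fun i => ?_
    · exact lcLimit.continuous_seminorm (meroNStep Q 𝓛) p fun k =>
        continuous_seminorm_mero (Q k) (p.comp (toMeroN Q 𝓛 k)) fun i => hp ⟨k, i⟩
    · have h := isClosed_perp_step (Q i.1) (h𝓛 i.1) i.2
      convert! h using 1
      ext e
      exact toMeroN_mem_perpRelN_iff h𝓛 hpr hcomp _ _

end MeroN

end MeroGerms

end

theorem mainTheorem8
    (𝓛 : ∀ k : ℕ, Set (Module.Dual ℂ (MeroGerms.V k)))
    (h𝓛 : ∀ k, MeroGerms.IsGeneratingSet (𝓛 k))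
    (hpr : ∀ k, ∀ L ∈ 𝓛 k, L ∘ₗ MeroGerms.pr k ∈ 𝓛 (k + 1))
    (Q : ∀ k : ℕ, MeroGerms.RealInner k)
    (hQ : ∀ k, ∀ v w : MeroGerms.V k,
      (Q (k + 1)).form (MeroGerms.inc v) (MeroGerms.inc w) = (Q k).form v w) :
    (∀ k, IsClosed (MeroGerms.perpRel (Q k) (𝓛 k))) ∧
    ((∀ k, ∀ L : Module.Dual ℂ (MeroGerms.V k),
        (Q (k + 1)).riesz (L ∘ₗ MeroGerms.pr k) = MeroGerms.inc ((Q k).riesz L)) →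
      IsClosed (MeroGerms.perpRelN Q 𝓛)) :=
  ⟨fun k => MeroGerms.isClosed_perpRel (Q k) (h𝓛 k), fun hr =>
    MeroGerms.isClosed_perpRelN h𝓛 hpr fun k => ⟨hQ k, hr k⟩⟩
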